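/- Let $k\ge 1$, let $\Lambda\subset\mathbb{R}^p$ and $\mathcal{D}_i\subset\mathbb{R}^{d_i}$ ($1\le i\le k$) be nonempty Polish subspaces with their Borel $\sigma$-algebras, let $\phi_i:\Lambda\to\mathcal{D}_i$ be Borel measurable maps, and let $P_{\mathrm{obs},i}$ be a probability measure on $\mathcal{D}_i$ for each $i$. Assume that $\Lambda$ has positive and finite Lebesgue measure, and let $P^0$ be the uniform probability measure on $\Lambda$ (normalized Lebesgue measure). Let $$\mathbb{P}=\{P \text{ a probability measure on }\Lambda:\ P\ll P^0,\ P\circ\phi_i^{-1}=P_{\mathrm{obs},i}\text{ for } 1\le i\le k\}.$$ Define $P^1,P^2,\dots$ by the iterative data-consistent inversion (DCI) scheme: for $n\ge 1$ let $i\in\{1,\dots,k\}$ with $i\equiv n \pmod k$, let $(P^{n-1}_{\omega})_{\omega\in\mathcal{D}_i}$ be the disintegration of $P^{n-1}$ along $\phi_i$ (the regular conditional distribution given $\phi_i=\omega$), and put $$P^n(\cdot)=\int_{\mathcal{D}_i}P^{n-1}_{\omega}(\cdot)\,dP_{\mathrm{obs},i}(\omega).$$ Suppose that $\inf_{P\in\mathbb{P}}\mathrm{KL}(P\,\|\,P^0)<\infty$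 and that there is a constant $C>0$ such that for every $1\le i\le k$, with $Q^0_i=P^0\circ\phi_i^{-1}$, $$\frac1C\le\frac{dP_{\mathrm{obs},i}}{dQ^0_i}\le C\qquad Q^0_i\text{-almost everywhere}.$$ Then $P^n$ converges in total variation to a measure $P^\infty\in\mathbb{P}$ that minimizes $\mathrm{KL}(P\,\|\,P^0)$ over $P\in\mathbb{P}$, and $P^\infty$ has maximal entropy in $\mathbb{P}$: writing $h(P)=-\int_\Lambda \frac{dP}{d\lambda}\log\frac{dP}{d\lambda}\,d\lambda\in[-\infty,\infty)$ for the differential entropy with respect to Lebesgue measure $\lambda$ on $\Lambda$, $$h(P)<h(P^\infty)\qquad\text{for every } P\in\mathbb{P},\ P\ne P^\infty .$$ -/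

import Mathlib

open MeasureTheory Filter
open scoped ENNReal Topology

noncomputable section

namespace IterativeDCI

/-- The total variation distance `sup_A |P(A) - Q(A)|` over measurable events `A`. -/
def tvDist {X : Type*} [MeasurableSpace X] (P Q : ProbabilityMeasure X) : ℝ :=
  ⨆ A : {A : Set X // MeasurableSet A},
    |(P : Measure X).real (A : Set X) - (Q : Measure X).real (A : Set X)|

/-- Lebesgue measure on a subset `s` of a Euclidean space, as a measure on the subtype `s`. -/
def lebesgueOn {p : ℕ} (s : Set (EuclideanSpace ℝ (Fin p))) : Measure s :=
  (volume : Measure (EuclideanSpace ℝ (Fin p))).comap Subtype.val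

/-- `P` is the uniform distribution with respect to the reference measure `ν`: the measure `ν`
divided by its total mass. Since `P` is a probability measure, this forces the total mass of `ν`
to be positive and finite. -/
def IsUniform {X : Type*} [MeasurableSpace X] (ν : Measure X) (P : ProbabilityMeasure X) : Prop :=
  (P : Measure X) = (ν Set.univ)⁻¹ • ν

open scoped Classical in
/-- The differential entropy `- ∫ p log p dν`, where `p = dP/dν`, with values in `[-∞, ∞]`: the
integral of the positive part of `- p log p` minus the integral of its negative part. The entropy
of a measure without density is `-∞`. (The first integral is finite when `ν` is finite.) -/
def differentialEntropy {X : Type*} [MeasurableSpace X] (ν : Measure X)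
    (P : ProbabilityMeasure X) : EReal :=
  if (P : Measure X) ≪ ν then
    ((∫⁻ x, ENNReal.ofReal
        (Real.negMulLog ((P : Measure X).rnDeriv ν x).toReal) ∂ν : ℝ≥0∞) : EReal)
    - ((∫⁻ x, ENNReal.ofReal
        (-Real.negMulLog ((P : Measure X).rnDeriv ν x).toReal) ∂ν : ℝ≥0∞) : EReal)
  else ⊥

section Scheme

variable {X : Type*} [MeasurableSpace X]

/-- The probability measures dominated by `Pinit` that satisfy one push-forward constraint. -/
def pullbackSet {Y : Type*} [MeasurableSpace Y] (Pinit : ProbabilityMeasure X)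
    (φ : X → Y) (Pobs : ProbabilityMeasure Y) : Set (ProbabilityMeasure X) :=
  {P | (P : Measure X) ≪ (Pinit : Measure X) ∧ (P : Measure X).map φ = (Pobs : Measure Y)}

/-- The solution set of the generalized stochastic inverse problem. -/
def gsipSet {k : ℕ} {Y : Fin k → Type*} [∀ i, MeasurableSpace (Y i)]
    (Pinit : ProbabilityMeasure X) (φ : ∀ i, X → Y i) (Pobs : ∀ i, ProbabilityMeasure (Y i)) :
    Set (ProbabilityMeasure X) :=
  ⋂ i, pullbackSet Pinit (φ i) (Pobs i)

variable [StandardBorelSpace X] [Nonempty X]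

/-- The data-consistent update `∫ P_ω(·) dPobs(ω)` of `P`, where `(P_ω)` is the disintegration of
`P` along `φ`, that is, the regular conditional distribution of the identity given `φ`. -/
def dciUpdate {Y : Type*} [MeasurableSpace Y] (φ : X → Y) (Pobs : ProbabilityMeasure Y)
    (P : ProbabilityMeasure X) : ProbabilityMeasure X :=
  ⟨(Pobs : Measure Y).bind (ProbabilityTheory.condDistrib (id : X → X) φ (P : Measure X)),
    inferInstance⟩

/-- The iterates of the scheme: starting from `Pinit`, the step `n → n + 1` applies the
data-consistent update for the constraint with (zero-based) index `n mod k`. -/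
def iterate {k : ℕ} [NeZero k] {Y : Fin k → Type*} [∀ i, MeasurableSpace (Y i)]
    (Pinit : ProbabilityMeasure X) (φ : ∀ i, X → Y i) (Pobs : ∀ i, ProbabilityMeasure (Y i)) :
    ℕ → ProbabilityMeasure X
  | 0 => Pinit
  | n + 1 => dciUpdate (φ (Fin.ofNat k n)) (Pobs (Fin.ofNat k n)) (iterate Pinit φ Pobs n)

end Scheme

end IterativeDCI

end

/-! An update multiplies the density by a factor `w n` that is a function of the data of one
constraint, so the iterates have densities f_n = ∏_{m<n} w_m with respect to P⁰. A feasible density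
p has the same marginal as f_{n+1} on the σ-algebra of step n, so, when p has finite entropy, ∫ p
log w_n = ∫ f_{n+1} log w_n = KL(f_{n+1} | f_n) =: κ_n. Summation gives the Pythagorean relation
KL(p | f_n) = ∫ p log p - Σ_{m<n} κ_m, hence Σ κ_m ≤ ∫ p log p.

Summability of κ makes the squared Hellinger steps summable, which is not yet a Cauchy property.
Were f_N itself feasible, the same identity would bound KL(f_N | f_l) by the tail Σ_{m≥l} κ_m. It is
nearly feasible: within one cycle of k steps every constraint was met by an iterate at squared
Hellinger distance at most η from f_N, where η is k times the entropy spent in that cycle.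
`integral_mul_log_le` turns this into ∫ f_N log w_m ≤ 17 κ_m + O(η), after f_N is cut off on a set
of mass O(η). Summing over m costs N η, and `exists_mul_window_lt` finds arbitrarily late N with N η
small, because the harmonic series diverges. So √f_n is Cauchy in L².

The limit q inherits the marginals, and Fatou gives KL(q | f_l) ≤ 17 Σ_{m≥l} κ_m. With l → ∞ this
yields ∫ q log q ≤ Σ κ_m ≤ ∫ p' log p' for every feasible p' of finite entropy; equality forces f_n
→ p', so p' = q. The entropy claim follows from h(P) = log λ(Λ) - KL(P | P⁰). -/

namespace IterativeDCI

/-! ### Densities, marginals on a sub-σ-algebra, and Hellinger distance. -/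

section Densities

variable {X : Type*} {m mX : MeasurableSpace X} {μ : Measure X}

/-- A real-valued probability density with respect to `μ`. -/
structure IsDensity (μ : Measure X) (a : X → ℝ) : Prop where
  measurable : Measurable a
  nonneg : ∀ x, 0 ≤ a x
  integrable : Integrable a μ
  integral_eq_one : ∫ x, a x ∂μ = 1

/-- The measures with densities `a` and `b` agree on the sub-σ-algebra `m`. -/
def MarginalEq (μ : Measure X) (m : MeasurableSpace X) (a b : X → ℝ) : Prop :=
  ∀ A, MeasurableSet[m] A →
    ∫⁻ x in A, ENNReal.ofReal (a x) ∂μ = ∫⁻ x in A, ENNReal.ofReal (b x) ∂μ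

theorem MarginalEq.symm {a b : X → ℝ} (h : MarginalEq μ m a b) :
    MarginalEq μ m b a := fun A hA => (h A hA).symm

theorem MarginalEq.trim_eq {a b : X → ℝ} (h : MarginalEq μ m a b)
    (hm : m ≤ mX) :
    (μ.withDensity fun x => ENNReal.ofReal (a x)).trim hm =
      (μ.withDensity fun x => ENNReal.ofReal (b x)).trim hm := by
  refine @Measure.ext _ m _ _ fun A hA => ?_
  rw [trim_measurableSet_eq hm hA, trim_measurableSet_eq hm hA, withDensity_apply _ (hm _ hA),
    withDensity_apply _ (hm _ hA), h A hA]

theorem MarginalEq.lintegral_mul {a b : X → ℝ} (h : MarginalEq μ m a b)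
    (hm : m ≤ mX) (ha : Measurable a) (hb : Measurable b) {g : X → ℝ≥0∞} (hg : Measurable[m] g) :
    ∫⁻ x, ENNReal.ofReal (a x) * g x ∂μ = ∫⁻ x, ENNReal.ofReal (b x) * g x ∂μ := by
  have hg' : Measurable g := hg.mono hm le_rfl
  have e : ∀ c : X → ℝ, Measurable c → ∫⁻ x, ENNReal.ofReal (c x) * g x ∂μ =
      ∫⁻ x, g x ∂((μ.withDensity fun x => ENNReal.ofReal (c x)).trim hm) := fun c hc => by
    rw [lintegral_trim hm hg, lintegral_withDensity_eq_lintegral_mul _ hc.ennreal_ofReal hg']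
    rfl
  rw [e a ha, e b hb, h.trim_eq hm]

theorem MarginalEq.integrable_mul {a b : X → ℝ} (h : MarginalEq μ m a b)
    (hm : m ≤ mX) (ha : IsDensity μ a) (hb : IsDensity μ b) {g : X → ℝ} (hg : Measurable[m] g)
    (hi : Integrable (fun x => a x * g x) μ) : Integrable (fun x => b x * g x) μ := by
  have hg' : Measurable g := hg.mono hm le_rfl
  refine ⟨(hb.measurable.mul hg').aestronglyMeasurable, ?_⟩
  have e : ∀ c : X → ℝ, IsDensity μ c → ∫⁻ x, ‖c x * g x‖ₑ ∂μ =
      ∫⁻ x, ENNReal.ofReal (c x) * ‖g x‖ₑ ∂μ := fun c hc => by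
    refine lintegral_congr fun x => ?_
    rw [enorm_mul, Real.enorm_of_nonneg (hc.nonneg x)]
  have := hi.2
  rw [HasFiniteIntegral, e a ha] at this
  rw [HasFiniteIntegral, e b hb, ← h.lintegral_mul hm ha.measurable hb.measurable]
  · exact this
  · exact measurable_enorm.comp hg

/-- Both sides integrate `g` against the same trimmed measure, so integrability plays no role. -/
theorem MarginalEq.integral_mul {a b : X → ℝ} (h : MarginalEq μ m a b)
    (hm : m ≤ mX) (ha : IsDensity μ a) (hb : IsDensity μ b) {g : X → ℝ} (hg : Measurable[m] g) :
    ∫ x, a x * g x ∂μ = ∫ x, b x * g x ∂μ := by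
  have e : ∀ c : X → ℝ, IsDensity μ c → ∫ x, c x * g x ∂μ =
      ∫ x, g x ∂((μ.withDensity fun x => ENNReal.ofReal (c x)).trim hm) := fun c hc => by
    rw [← integral_trim hm hg.stronglyMeasurable,
      integral_withDensity_eq_integral_toReal_smul hc.measurable.ennreal_ofReal
        (ae_of_all _ fun x => ENNReal.ofReal_lt_top)]
    refine integral_congr_ae (ae_of_all _ fun x => ?_)
    simp [ENNReal.toReal_ofReal (hc.nonneg x)]
  rw [e a ha, e b hb, h.trim_eq hm]

/-- A function squeezed between two integrable functions is integrable. -/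
theorem integrable_of_le_of_le_ae {u v g : X → ℝ} (hg : AEStronglyMeasurable g μ)
    (hu : Integrable u μ) (hv : Integrable v μ) (h1 : ∀ᵐ x ∂μ, u x ≤ g x)
    (h2 : ∀ᵐ x ∂μ, g x ≤ v x) : Integrable g μ := by
  refine (hu.abs.add hv.abs).mono' hg ?_
  filter_upwards [h1, h2] with x h1 h2
  rw [Real.norm_eq_abs, abs_le]
  have := neg_abs_le (u x)
  have := le_abs_self (v x)
  have := abs_nonneg (u x)
  have := abs_nonneg (v x)
  simp only [Pi.add_apply]
  constructor <;> linarith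

/-- The pointwise comparison of the Hellinger and Kullback-Leibler integrands. -/
theorem sqrt_sub_sqrt_sq_le {a b : ℝ} (ha : 0 < a) (hb : 0 < b) :
    (√a - √b) ^ 2 ≤ a * (Real.log a - Real.log b) - a + b := by
  have hsa := Real.sqrt_pos.2 ha
  have hsb := Real.sqrt_pos.2 hb
  -- The bound `1 - 1/t ≤ log t` at `t = √a / √b`; multiplied by `2 * a` it is the claim.
  have h := Real.one_sub_inv_le_log_of_pos (div_pos hsa hsb)
  rw [Real.log_div hsa.ne' hsb.ne', Real.log_sqrt ha.le, Real.log_sqrt hb.le, inv_div] at h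
  have h2 := mul_le_mul_of_nonneg_left h ha.le
  have e1 : a * (1 - √b / √a) = a - √a * √b := by
    have h3 : a / √a = √a := Real.div_sqrt
    rw [mul_sub, mul_one, mul_div_left_comm, h3, mul_comm]
  rw [e1] at h2
  nlinarith [Real.sq_sqrt ha.le, Real.sq_sqrt hb.le]

theorem integrable_sqrt_sub_sqrt_sq {a b : X → ℝ} (ha : Integrable a μ) (hb : Integrable b μ)
    (ha0 : ∀ x, 0 ≤ a x) (hb0 : ∀ x, 0 ≤ b x) :
    Integrable (fun x => (√(a x) - √(b x)) ^ 2) μ := by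
  refine Integrable.mono' ((ha.add hb).const_mul 2) ?_ (ae_of_all _ fun x => ?_)
  · exact ((Real.continuous_sqrt.comp_aestronglyMeasurable ha.1).sub
      (Real.continuous_sqrt.comp_aestronglyMeasurable hb.1)).pow 2
  · rw [Real.norm_of_nonneg (sq_nonneg _)]
    simp only [Pi.add_apply]
    nlinarith [Real.sq_sqrt (ha0 x), Real.sq_sqrt (hb0 x), sq_nonneg (√(a x) + √(b x))]

/-- The squared Hellinger distance is bounded by the (generalized) relative entropy. -/
theorem integral_sqrt_sub_sqrt_sq_le {a b t : X → ℝ} (ha : Integrable a μ) (hb : Integrable b μ)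
    (ha0 : ∀ x, 0 ≤ a x) (hb0 : ∀ x, 0 ≤ b x) (ht : Integrable (fun x => a x * t x) μ)
    (h : ∀ᵐ x ∂μ, 0 < a x → 0 < b x ∧ t x = Real.log (a x) - Real.log (b x)) :
    ∫ x, (√(a x) - √(b x)) ^ 2 ∂μ ≤ ∫ x, a x * t x ∂μ - ∫ x, a x ∂μ + ∫ x, b x ∂μ := by
  have e : ∫ x, a x * t x ∂μ - ∫ x, a x ∂μ + ∫ x, b x ∂μ =
      ∫ x, (a x * t x - a x + b x) ∂μ := by
    rw [← integral_sub ht ha]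
    exact (integral_add (ht.sub ha) hb).symm
  rw [e]
  refine integral_mono_ae (integrable_sqrt_sub_sqrt_sq ha hb ha0 hb0) ((ht.sub ha).add hb) ?_
  filter_upwards [h] with x hx
  rcases (ha0 x).eq_or_lt with h0 | h0
  · simp [← h0, Real.sq_sqrt (hb0 x)]
  · obtain ⟨h1, h2⟩ := hx h0
    simp only [h2]
    exact sqrt_sub_sqrt_sq_le h0 h1

/-- The square root of a nonnegative integrable function, as an element of `L²`. -/
noncomputable def sqrtLp {a : X → ℝ} (ha : Integrable a μ) (ha0 : ∀ x, 0 ≤ a x) : Lp ℝ 2 μ :=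
  MemLp.toLp (fun x => √(a x)) ((memLp_two_iff_integrable_sq
    (Real.continuous_sqrt.comp_aestronglyMeasurable ha.1)).2
    (ha.congr (ae_of_all _ fun x => (Real.sq_sqrt (ha0 x)).symm)))

theorem norm_sq_Lp_two (g : Lp ℝ 2 μ) : ‖g‖ ^ 2 = ∫ x, (g x) ^ 2 ∂μ := by
  rw [← real_inner_self_eq_norm_sq, L2.inner_def]
  refine integral_congr_ae (ae_of_all _ fun x => ?_)
  simp [pow_two]

theorem coeFn_sqrtLp {a : X → ℝ} (ha : Integrable a μ) (ha0 : ∀ x, 0 ≤ a x) :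
    sqrtLp ha ha0 =ᵐ[μ] fun x => √(a x) := MemLp.coeFn_toLp _

theorem norm_sqrtLp_sub_sq {a b : X → ℝ} (ha : Integrable a μ) (hb : Integrable b μ)
    (ha0 : ∀ x, 0 ≤ a x) (hb0 : ∀ x, 0 ≤ b x) :
    ‖sqrtLp ha ha0 - sqrtLp hb hb0‖ ^ 2 = ∫ x, (√(a x) - √(b x)) ^ 2 ∂μ := by
  rw [norm_sq_Lp_two]
  refine integral_congr_ae ?_
  filter_upwards [Lp.coeFn_sub (sqrtLp ha ha0) (sqrtLp hb hb0), coeFn_sqrtLp ha ha0,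
    coeFn_sqrtLp hb hb0] with x h1 h2 h3
  rw [h1, Pi.sub_apply, h2, h3]

theorem norm_sqrtLp_sq {a : X → ℝ} (ha : Integrable a μ) (ha0 : ∀ x, 0 ≤ a x) :
    ‖sqrtLp ha ha0‖ ^ 2 = ∫ x, a x ∂μ := by
  rw [norm_sq_Lp_two]
  refine integral_congr_ae ?_
  filter_upwards [coeFn_sqrtLp ha ha0] with x h1
  rw [h1, Real.sq_sqrt (ha0 x)]

/-- The `L¹` distance is bounded by the Hellinger distance. -/
theorem integral_abs_sub_le {a b : X → ℝ} (ha : IsDensity μ a) (hb : IsDensity μ b) :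
    ∫ x, |a x - b x| ∂μ ≤ 2 * √(∫ x, (√(a x) - √(b x)) ^ 2 ∂μ) := by
  set u := sqrtLp ha.integrable ha.nonneg
  set v := sqrtLp hb.integrable hb.nonneg
  have hu : ‖u‖ = 1 := by
    have := norm_sqrtLp_sq ha.integrable ha.nonneg
    rw [ha.integral_eq_one] at this
    nlinarith [norm_nonneg u]
  have hv : ‖v‖ = 1 := by
    have := norm_sqrtLp_sq hb.integrable hb.nonneg
    rw [hb.integral_eq_one] at this
    nlinarith [norm_nonneg v]
  have hd : √(∫ x, (√(a x) - √(b x)) ^ 2 ∂μ) = ‖u - v‖ := by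
    rw [← norm_sqrtLp_sub_sq ha.integrable hb.integrable ha.nonneg hb.nonneg]
    exact Real.sqrt_sq (norm_nonneg _)
  have hi : ∫ x, |a x - b x| ∂μ = inner ℝ |u - v| (u + v) := by
    rw [L2.inner_def]
    refine integral_congr_ae ?_
    filter_upwards [Lp.coeFn_sub u v, Lp.coeFn_add u v, Lp.coeFn_abs (u - v),
      coeFn_sqrtLp ha.integrable ha.nonneg, coeFn_sqrtLp hb.integrable hb.nonneg]
      with x h1 h2 h3 h4 h5
    rw [h3, h1, h2, Pi.sub_apply, Pi.add_apply, h4, h5]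
    have e : a x - b x = (√(a x) - √(b x)) * (√(a x) + √(b x)) := by
      nlinarith [Real.sq_sqrt (ha.nonneg x), Real.sq_sqrt (hb.nonneg x)]
    rw [e, abs_mul, abs_of_nonneg (add_nonneg (Real.sqrt_nonneg _) (Real.sqrt_nonneg _))]
    simp [mul_comm]
  rw [hi, hd]
  calc inner ℝ |u - v| (u + v) ≤ ‖|u - v|‖ * ‖u + v‖ := real_inner_le_norm _ _
    _ ≤ ‖u - v‖ * (‖u‖ + ‖v‖) := by
        rw [norm_abs_eq_norm]
        exact mul_le_mul_of_nonneg_left (norm_add_le _ _) (norm_nonneg _)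
    _ = 2 * ‖u - v‖ := by rw [hu, hv]; ring

end Densities

/-! ### Products of update factors and the Pythagorean relation. -/

section Scaling

variable {X ι : Type*} {mX : MeasurableSpace X} {μ : Measure X}

/-- The density of the `n`-th iterate, as the product of the update factors. -/
def iterDensity (w : ℕ → X → ℝ) (n : ℕ) (x : X) : ℝ := ∏ m ∈ Finset.range n, w m x

/-- The logarithm of `iterDensity`, as the sum of the logarithms of the update factors. -/
noncomputable def iterLog (w : ℕ → X → ℝ) (n : ℕ) (x : X) : ℝ :=
  ∑ m ∈ Finset.range n, Real.log (w m x)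

/-- The relative entropy of the iterate `n + 1` with respect to the iterate `n`. -/
noncomputable def stepEntropy (μ : Measure X) (w : ℕ → X → ℝ) (n : ℕ) : ℝ :=
  ∫ x, iterDensity w (n + 1) x * Real.log (w n x) ∂μ

/-- Update factors `w n`, measurable with respect to the sub-σ-algebras `𝓢 (j n)`, whose partial
products are probability densities. -/
structure IsScaling (μ : Measure X) (𝓢 : ι → MeasurableSpace X) (j : ℕ → ι) (w : ℕ → X → ℝ) :
    Prop where
  le : ∀ i, 𝓢 i ≤ mX
  measurable : ∀ n, Measurable[𝓢 (j n)] (w n)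
  nonneg : ∀ n x, 0 ≤ w n x
  density : ∀ n, IsDensity μ (iterDensity w n)

/-- A density that has the prescribed marginals: after each update, the iterate agrees with it on
the σ-algebra of that update. -/
structure IsFeasible (μ : Measure X) (𝓢 : ι → MeasurableSpace X) (j : ℕ → ι) (w : ℕ → X → ℝ)
    (p : X → ℝ) : Prop where
  density : IsDensity μ p
  marginal : ∀ n, MarginalEq μ (𝓢 (j n)) p (iterDensity w (n + 1))

variable {𝓢 : ι → MeasurableSpace X} {j : ℕ → ι} {w : ℕ → X → ℝ} {p : X → ℝ}

theorem iterDensity_succ (w : ℕ → X → ℝ) (n : ℕ) (x : X) :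
    iterDensity w (n + 1) x = iterDensity w n x * w n x := Finset.prod_range_succ _ _

theorem iterLog_succ (w : ℕ → X → ℝ) (n : ℕ) (x : X) :
    iterLog w (n + 1) x = iterLog w n x + Real.log (w n x) := Finset.sum_range_succ _ _

theorem IsScaling.measurable' (h : IsScaling μ 𝓢 j w) (n : ℕ) : Measurable (w n) :=
  (h.measurable n).mono (h.le _) le_rfl

theorem IsScaling.measurable_iterLog (h : IsScaling μ 𝓢 j w) (n : ℕ) :
    Measurable (iterLog w n) :=
  Finset.measurable_fun_sum _ fun m _ => (h.measurable' m).log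

theorem IsScaling.pos_of_iterDensity_pos (h : IsScaling μ 𝓢 j w) {n : ℕ} {x : X}
    (hx : 0 < iterDensity w n x) {m : ℕ} (hm : m < n) : 0 < w m x := by
  refine (h.nonneg m x).lt_of_ne fun h0 => hx.ne' ?_
  exact Finset.prod_eq_zero (Finset.mem_range.2 hm) h0.symm

theorem IsScaling.iterDensity_pos_of_le (h : IsScaling μ 𝓢 j w) {n l : ℕ} {x : X}
    (hx : 0 < iterDensity w n x) (hl : l ≤ n) : 0 < iterDensity w l x :=
  Finset.prod_pos fun _ hm =>
    h.pos_of_iterDensity_pos hx ((Finset.mem_range.1 hm).trans_le hl)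

theorem IsScaling.log_iterDensity (h : IsScaling μ 𝓢 j w) {n : ℕ} {x : X}
    (hx : 0 < iterDensity w n x) : Real.log (iterDensity w n x) = iterLog w n x :=
  Real.log_prod fun _ hm => (h.pos_of_iterDensity_pos hx (Finset.mem_range.1 hm)).ne'

/-- The event `w n = 0` lies in `𝓢 (j n)` and has no mass under the iterate `n + 1`, hence none
under `p`. -/
theorem IsFeasible.ae_factor_pos (h : IsScaling μ 𝓢 j w) (hp : IsFeasible μ 𝓢 j w p) (n : ℕ) :
    ∀ᵐ x ∂μ, 0 < p x → 0 < w n x := by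
  have hA : MeasurableSet[𝓢 (j n)] {x | w n x = 0} := h.measurable n (measurableSet_singleton 0)
  have hA' := h.le _ _ hA
  have e := hp.marginal n _ hA
  rw [setLIntegral_congr_fun (f := fun x => ENNReal.ofReal (iterDensity w (n + 1) x))
    (g := fun _ => 0) hA'
    (fun x (hx : w n x = 0) => by simp [iterDensity_succ, hx]), lintegral_zero,
    lintegral_eq_zero_iff hp.density.measurable.ennreal_ofReal,
    EventuallyEq, ae_restrict_iff' hA'] at e
  filter_upwards [e] with x hx hpx
  refine (h.nonneg n x).lt_of_ne fun h0 => ?_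
  have := hx h0.symm
  simp only [Pi.zero_apply, ENNReal.ofReal_eq_zero] at this
  linarith

theorem IsFeasible.ae_iterDensity_pos (h : IsScaling μ 𝓢 j w) (hp : IsFeasible μ 𝓢 j w p)
    (n : ℕ) : ∀ᵐ x ∂μ, 0 < p x → 0 < iterDensity w n x := by
  have := ae_all_iff.2 fun m => hp.ae_factor_pos h m
  filter_upwards [this] with x hx hpx
  exact Finset.prod_pos fun m _ => hx m hpx

/-- By equality of marginals `p` may be replaced by f_{n+1}, and f_{n+1} / w_n is f_n where `w n ≠
0`. Where `w n = 0` it is 0 because `0⁻¹ = 0`, hence an inequality only. -/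
theorem IsFeasible.integrable_mul_inv (h : IsScaling μ 𝓢 j w) (hp : IsFeasible μ 𝓢 j w p)
    (n : ℕ) : Integrable (fun x => p x * (w n x)⁻¹) μ ∧ ∫ x, p x * (w n x)⁻¹ ∂μ ≤ 1 := by
  have hle : ∀ x, iterDensity w (n + 1) x * (w n x)⁻¹ ≤ iterDensity w n x := fun x => by
    rw [iterDensity_succ, mul_assoc]
    exact mul_le_of_le_one_right ((h.density n).nonneg x) mul_inv_le_one
  have hnn : ∀ x, 0 ≤ iterDensity w (n + 1) x * (w n x)⁻¹ := fun x =>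
    mul_nonneg ((h.density _).nonneg x) (inv_nonneg.2 (h.nonneg n x))
  have hi : Integrable (fun x => iterDensity w (n + 1) x * (w n x)⁻¹) μ := by
    refine (h.density n).integrable.mono'
      ((h.density _).measurable.mul (h.measurable' n).inv).aestronglyMeasurable
      (ae_of_all _ fun x => ?_)
    rw [Real.norm_of_nonneg (hnn x)]
    exact hle x
  have hg : Measurable[𝓢 (j n)] fun x => (w n x)⁻¹ := (h.measurable n).inv
  refine ⟨(hp.marginal n).symm.integrable_mul (h.le _) (h.density _) hp.density hg hi, ?_⟩
  rw [(hp.marginal n).integral_mul (h.le _) hp.density (h.density _) hg,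
    ← (h.density n).integral_eq_one]
  exact integral_mono hi (h.density n).integrable hle

/-- For a feasible density of finite entropy, all the logarithmic factors are integrable. -/
theorem IsFeasible.integrable_mul_iterLog (h : IsScaling μ 𝓢 j w) (hp : IsFeasible μ 𝓢 j w p)
    (hfin : Integrable (fun x => p x * Real.log (p x)) μ) (n : ℕ) :
    Integrable (fun x => p x * iterLog w n x) μ ∧
      Integrable (fun x => p x * Real.log (w n x)) μ := by
  have step : ∀ n, Integrable (fun x => p x * iterLog w n x) μ →
      Integrable (fun x => p x * Real.log (w n x)) μ := fun n hn => by
    -- `p log w_n` lies between `p - p / w_n` and `f_{n+1} + p log p - p * iterLog w n`; the upper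
    -- bound is the nonnegativity of the integrand of KL(p | f_{n+1}).
    refine integrable_of_le_of_le_ae
      (hp.density.measurable.mul (h.measurable' n).log).aestronglyMeasurable
      (hp.density.integrable.sub (hp.integrable_mul_inv h n).1)
      (((h.density (n + 1)).integrable.add hfin).sub hn) ?_ ?_
    · filter_upwards [hp.ae_factor_pos h n] with x hx
      rcases (hp.density.nonneg x).eq_or_lt with h0 | h0
      · simp [← h0]
      · have := mul_le_mul_of_nonneg_left (Real.one_sub_inv_le_log_of_pos (hx h0)) h0.le
        rw [mul_sub, mul_one] at this
        exact this
    · filter_upwards [hp.ae_iterDensity_pos h (n + 1)] with x hx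
      simp only [Pi.sub_apply, Pi.add_apply]
      rcases (hp.density.nonneg x).eq_or_lt with h0 | h0
      · simpa [← h0] using (h.density (n + 1)).nonneg x
      · have h1 := sqrt_sub_sqrt_sq_le h0 (hx h0)
        rw [h.log_iterDensity (hx h0), iterLog_succ] at h1
        nlinarith [sq_nonneg (√(p x) - √(iterDensity w (n + 1) x))]
  have main : ∀ n, Integrable (fun x => p x * iterLog w n x) μ := fun n => by
    induction n with
    | zero => simp [iterLog]
    | succ n ih =>
      simp only [iterLog_succ, mul_add]
      exact ih.add (step n ih)
  exact ⟨main n, step n (main n)⟩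

/-- `log (w n)` sees only the marginal on `𝓢 (j n)`. Thus a step gains the same entropy against
every feasible density, which is what makes the relative entropies telescope. -/
theorem IsFeasible.stepEntropy_eq (h : IsScaling μ 𝓢 j w) (hp : IsFeasible μ 𝓢 j w p) (n : ℕ) :
    stepEntropy μ w n = ∫ x, p x * Real.log (w n x) ∂μ :=
  ((hp.marginal n).integral_mul (h.le _) hp.density (h.density _) (h.measurable n).log).symm

theorem IsFeasible.integral_mul_iterLog (h : IsScaling μ 𝓢 j w) (hp : IsFeasible μ 𝓢 j w p)
    (hfin : Integrable (fun x => p x * Real.log (p x)) μ) (n : ℕ) :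
    ∫ x, p x * iterLog w n x ∂μ = ∑ m ∈ Finset.range n, stepEntropy μ w m := by
  simp only [iterLog, Finset.mul_sum]
  rw [integral_finsetSum _ fun m _ => (hp.integrable_mul_iterLog h hfin m).2]
  exact Finset.sum_congr rfl fun m _ => (hp.stepEntropy_eq h m).symm

/-- The Pythagorean relation, with the relative entropy bounded below by a Hellinger distance. -/
theorem IsFeasible.hellinger_le (h : IsScaling μ 𝓢 j w) (hp : IsFeasible μ 𝓢 j w p)
    (hfin : Integrable (fun x => p x * Real.log (p x)) μ) (n : ℕ) :
    ∫ x, (√(p x) - √(iterDensity w n x)) ^ 2 ∂μ ≤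
      ∫ x, p x * Real.log (p x) ∂μ - ∑ m ∈ Finset.range n, stepEntropy μ w m := by
  have hi := (hp.integrable_mul_iterLog h hfin n).1
  have e : ∀ x, p x * (Real.log (p x) - iterLog w n x) =
      p x * Real.log (p x) - p x * iterLog w n x := fun x => mul_sub _ _ _
  have := integral_sqrt_sub_sqrt_sq_le (t := fun x => Real.log (p x) - iterLog w n x)
    hp.density.integrable (h.density n).integrable hp.density.nonneg (h.density n).nonneg
    (by simp only [e]; exact hfin.sub hi) (by
      filter_upwards [hp.ae_iterDensity_pos h n] with x hx hpx
      exact ⟨hx hpx, by rw [h.log_iterDensity (hx hpx)]⟩)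
  simp only [e] at this
  rwa [integral_sub hfin hi, hp.density.integral_eq_one, (h.density n).integral_eq_one,
    sub_add_cancel, hp.integral_mul_iterLog h hfin] at this

theorem IsFeasible.hellinger_step_le (h : IsScaling μ 𝓢 j w) (hp : IsFeasible μ 𝓢 j w p)
    (hfin : Integrable (fun x => p x * Real.log (p x)) μ) (n : ℕ) :
    ∫ x, (√(iterDensity w (n + 1) x) - √(iterDensity w n x)) ^ 2 ∂μ ≤ stepEntropy μ w n := by
  have := integral_sqrt_sub_sqrt_sq_le (t := fun x => Real.log (w n x))
    (h.density (n + 1)).integrable (h.density n).integrable (h.density _).nonneg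
    (h.density n).nonneg
    ((hp.marginal n).integrable_mul (h.le _) hp.density (h.density _) (h.measurable n).log
      (hp.integrable_mul_iterLog h hfin n).2) (ae_of_all _ fun x hx => by
      have h1 := h.iterDensity_pos_of_le hx n.le_succ
      exact ⟨h1, by rw [h.log_iterDensity hx, h.log_iterDensity h1, iterLog_succ]; ring⟩)
  rwa [(h.density (n + 1)).integral_eq_one, (h.density n).integral_eq_one,
    sub_add_cancel] at this

theorem IsFeasible.stepEntropy_nonneg (h : IsScaling μ 𝓢 j w) (hp : IsFeasible μ 𝓢 j w p)
    (hfin : Integrable (fun x => p x * Real.log (p x)) μ) (n : ℕ) : 0 ≤ stepEntropy μ w n :=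
  (integral_nonneg fun _ => sq_nonneg _).trans (hp.hellinger_step_le h hfin n)

theorem IsFeasible.sum_stepEntropy_le (h : IsScaling μ 𝓢 j w) (hp : IsFeasible μ 𝓢 j w p)
    (hfin : Integrable (fun x => p x * Real.log (p x)) μ) (n : ℕ) :
    ∑ m ∈ Finset.range n, stepEntropy μ w m ≤ ∫ x, p x * Real.log (p x) ∂μ :=
  sub_nonneg.1 ((integral_nonneg fun _ => sq_nonneg _).trans (hp.hellinger_le h hfin n))

theorem IsFeasible.summable_stepEntropy (h : IsScaling μ 𝓢 j w) (hp : IsFeasible μ 𝓢 j w p)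
    (hfin : Integrable (fun x => p x * Real.log (p x)) μ) : Summable (stepEntropy μ w) :=
  summable_of_sum_range_le (hp.stepEntropy_nonneg h hfin) (hp.sum_stepEntropy_le h hfin)

/-- The part of `log r` where `r ≤ e`. -/
noncomputable def logLow (r : ℝ) : ℝ := if r ≤ Real.exp 1 then Real.log r else 0

/-- The part of `log r` where `r > e`. -/
noncomputable def logHigh (r : ℝ) : ℝ := if r ≤ Real.exp 1 then 0 else Real.log r

theorem logLow_add_logHigh (r : ℝ) : logLow r + logHigh r = Real.log r := by
  unfold logLow logHigh; split_ifs <;> simp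

theorem logHigh_nonneg (r : ℝ) : 0 ≤ logHigh r := by
  unfold logHigh; split_ifs with h
  · rfl
  · exact Real.log_nonneg (by linarith [Real.add_one_le_exp (1 : ℝ)])

theorem measurable_logLow : Measurable logLow :=
  Measurable.ite measurableSet_Iic Real.measurable_log measurable_const

theorem measurable_logHigh : Measurable logHigh :=
  Measurable.ite measurableSet_Iic measurable_const Real.measurable_log

theorem abs_logLow_le (r : ℝ) : |logLow r| ≤ |Real.log r| := by
  unfold logLow; split_ifs <;> simp

theorem logHigh_le_abs (r : ℝ) : logHigh r ≤ |Real.log r| := by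
  unfold logHigh; split_ifs
  · simp
  · exact le_abs_self _

/-- With `t = log r` the right side is `4 * (exp (-t) - 1 + t)`, quadratic near `t = 0` but only
linear as `t → ∞`; hence the cut at `r = e`, with a square below and a first power above. For `r = w
n` its integral against `p` is at most `4 * stepEntropy μ w n`. -/
theorem logLow_sq_le {r : ℝ} (hr : 0 < r) : logLow r ^ 2 ≤ 4 * (Real.log r - 1 + r⁻¹) := by
  unfold logLow
  split_ifs with h
  · have ht : Real.log r ≤ 1 := (Real.log_le_iff_le_exp hr).2 h
    have he : r⁻¹ = Real.exp (-Real.log r) := by rw [Real.exp_neg, Real.exp_log hr]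
    rw [he]
    generalize Real.log r = t at ht
    rcases le_or_gt t 0 with h0 | h0
    · have := Real.quadratic_le_exp_of_nonneg (neg_nonneg.2 h0)
      nlinarith [sq_nonneg t]
    -- The Taylor remainder gives `exp (-t) - 1 + t ≥ t²/2 - (2/9) t³ ≥ (5/18) t²` on `(0, 1]`, and
    -- `5/18 > 1/4`.
    · have hb := Real.exp_bound (x := -t) (by rw [abs_neg, abs_of_pos h0]; exact ht)
        (n := 3) (by norm_num)
      rw [abs_neg, abs_of_pos h0] at hb
      have hb' := (abs_le.1 hb).1
      norm_num [Finset.sum_range_succ, Nat.factorial] at hb'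
      have : t ^ 3 ≤ t ^ 2 := by nlinarith [sq_nonneg t]
      nlinarith
  · have := Real.one_sub_inv_le_log_of_pos hr
    nlinarith

theorem logHigh_le {r : ℝ} (hr : 0 < r) : logHigh r ≤ 4 * (Real.log r - 1 + r⁻¹) := by
  unfold logHigh
  split_ifs with h
  · have := Real.one_sub_inv_le_log_of_pos hr
    nlinarith
  · have ht : 1 < Real.log r := (Real.lt_log_iff_exp_lt hr).2 (not_le.1 h)
    have he : r⁻¹ = Real.exp (-1) * Real.exp (1 - Real.log r) := by
      rw [← Real.exp_add, show -1 + (1 - Real.log r) = -Real.log r by ring, Real.exp_neg,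
        Real.exp_log hr]
    rw [he]
    generalize Real.log r = t at ht
    -- Tangent line at `t = 1`: `exp (-t) ≥ exp (-1) * (2 - t)`. The remaining inequality is linear
    -- in `t` and needs only `1/3 ≤ exp (-1) ≤ 1/2`.
    have h1 := Real.add_one_le_exp (1 - t)
    have h2 : (1 / 3 : ℝ) ≤ Real.exp (-1) := by
      rw [Real.exp_neg, ← one_div]
      exact one_div_le_one_div_of_le (Real.exp_pos 1) (by linarith [Real.exp_one_lt_d9])
    have h3 : Real.exp (-1) ≤ 1 / 2 := by
      rw [Real.exp_neg, ← one_div]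
      exact one_div_le_one_div_of_le (by norm_num) (by linarith [Real.exp_one_gt_d9])
    have h4 : Real.exp (-1) * (1 - t + 1) ≤ Real.exp (-1) * Real.exp (1 - t) :=
      mul_le_mul_of_nonneg_left h1 (Real.exp_pos _).le
    nlinarith

end Scaling

/-! ### Cutting a density down to one with a dominated marginal. -/

section Domination

variable {X : Type*} {m mX : MeasurableSpace X} {μ : Measure X} {a b p : X → ℝ}

/-- On the sub-σ-algebra `m`, the measure with density `a` is at most twice the one with
density `p`. -/
def MarginalDominated (μ : Measure X) (m : MeasurableSpace X) (a p : X → ℝ) : Prop :=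
  ∀ g : X → ℝ≥0∞, Measurable[m] g →
    ∫⁻ x, ENNReal.ofReal (a x) * g x ∂μ ≤ 2 * ∫⁻ x, ENNReal.ofReal (p x) * g x ∂μ

theorem MarginalDominated.integrable_mul (h : MarginalDominated μ m a p) (hm : m ≤ mX)
    (ha : Measurable a) (ha0 : ∀ x, 0 ≤ a x) (hp0 : ∀ x, 0 ≤ p x)
    {g : X → ℝ} (hg : Measurable[m] g) (hi : Integrable (fun x => p x * g x) μ) :
    Integrable (fun x => a x * g x) μ := by
  have hg' : Measurable g := hg.mono hm le_rfl
  refine ⟨(ha.mul hg').aestronglyMeasurable, ?_⟩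
  have e : ∀ c : X → ℝ, (∀ x, 0 ≤ c x) → ∫⁻ x, ‖c x * g x‖ₑ ∂μ =
      ∫⁻ x, ENNReal.ofReal (c x) * ‖g x‖ₑ ∂μ := fun c hc => by
    refine lintegral_congr fun x => ?_
    rw [enorm_mul, Real.enorm_of_nonneg (hc x)]
  have := hi.2
  rw [HasFiniteIntegral, e p hp0] at this
  rw [HasFiniteIntegral, e a ha0]
  exact (h _ (measurable_enorm.comp hg)).trans_lt (ENNReal.mul_lt_top (by simp) this)

theorem MarginalDominated.integral_mul_le (h : MarginalDominated μ m a p) (hm : m ≤ mX)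
    (ha : Measurable a) (ha0 : ∀ x, 0 ≤ a x) (hp0 : ∀ x, 0 ≤ p x)
    {g : X → ℝ} (hg : Measurable[m] g) (hg0 : ∀ x, 0 ≤ g x)
    (hi : Integrable (fun x => p x * g x) μ) :
    ∫ x, a x * g x ∂μ ≤ 2 * ∫ x, p x * g x ∂μ := by
  have hia := h.integrable_mul hm ha ha0 hp0 hg hi
  have e : ∀ c : X → ℝ, (∀ x, 0 ≤ c x) → Integrable (fun x => c x * g x) μ →
      ENNReal.ofReal (∫ x, c x * g x ∂μ) =
      ∫⁻ x, ENNReal.ofReal (c x) * ENNReal.ofReal (g x) ∂μ := fun c hc hci => by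
    rw [ofReal_integral_eq_lintegral_ofReal hci (ae_of_all _ fun x => mul_nonneg (hc x) (hg0 x))]
    exact lintegral_congr fun x => ENNReal.ofReal_mul (hc x)
  have h0 : 0 ≤ ∫ x, p x * g x ∂μ := integral_nonneg fun x => mul_nonneg (hp0 x) (hg0 x)
  rw [← ENNReal.ofReal_le_ofReal_iff (by positivity), ENNReal.ofReal_mul (by norm_num), e a ha0 hia,
    e p hp0 hi]
  simpa using h _ (ENNReal.measurable_ofReal.comp hg)

theorem MarginalDominated.mono {a' : X → ℝ} (h : MarginalDominated μ m a p)
    (ha : ∀ x, a' x ≤ a x) : MarginalDominated μ m a' p := fun g hg =>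
  (lintegral_mono fun x => by gcongr; exact ha x).trans (h g hg)

/-- There is a set of `m` on which the `m`-marginal of `a` is at most twice that of `p`, and
outside of which `a` has a mass controlled by the Hellinger distance of `a` to any density with
the same `m`-marginal as `p`. -/
theorem exists_dominated_set (hm : m ≤ mX) (ha : IsDensity μ a) (hp : IsDensity μ p) :
    ∃ G, MeasurableSet[m] G ∧ MarginalDominated μ m (G.indicator a) p ∧
      ∀ b, IsDensity μ b → MarginalEq μ m p b →
        ∫ x in Gᶜ, a x ∂μ ≤ 12 * ∫ x, (√(a x) - √(b x)) ^ 2 ∂μ := by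
  have hfin : ∀ c, IsDensity μ c →
      IsFiniteMeasure (μ.withDensity fun x => ENNReal.ofReal (c x)) := fun c hc =>
    isFiniteMeasure_withDensity_ofReal hc.integrable.2
  have := hfin a ha
  have := hfin p hp
  set α := (μ.withDensity fun x => ENNReal.ofReal (a x)).trim hm with hα
  set β := (μ.withDensity fun x => ENNReal.ofReal (p x)).trim hm with hβ
  have hval : ∀ c : X → ℝ, ∀ A, MeasurableSet[m] A →
      (μ.withDensity fun x => ENNReal.ofReal (c x)).trim hm A =
        ∫⁻ x in A, ENNReal.ofReal (c x) ∂μ := fun c A hA => by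
    rw [trim_measurableSet_eq hm hA, withDensity_apply _ (hm _ hA)]
  have hlin : ∀ c : X → ℝ, Measurable c → ∀ g : X → ℝ≥0∞, Measurable[m] g →
      ∫⁻ x, ENNReal.ofReal (c x) * g x ∂μ =
      ∫⁻ x, g x ∂((μ.withDensity fun x => ENNReal.ofReal (c x)).trim hm) := fun c hc g hg => by
    rw [lintegral_trim hm hg, lintegral_withDensity_eq_lintegral_mul _ hc.ennreal_ofReal
      (hg.mono hm le_rfl)]
    rfl
  -- The decomposition is taken on the σ-algebra `m`: `α ≤ 2β` inside `G` and `2β ≤ α` outside.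
  obtain ⟨G, hG, h1, h2⟩ := @hahn_decomposition X m ((2 : NNReal) • β) α _ _
  have hG' := hm _ hG
  refine ⟨G, hG, fun g hg => ?_, fun b hb hpb => ?_⟩
  · have e1 : ∫⁻ x, ENNReal.ofReal (G.indicator a x) * g x ∂μ =
        ∫⁻ x, ENNReal.ofReal (a x) * G.indicator g x ∂μ := by
      refine lintegral_congr fun x => ?_
      by_cases hx : x ∈ G <;> simp [hx]
    have hle : @Measure.restrict X m α G ≤ (2 : NNReal) • β := by
      refine (@Measure.le_iff X m _ _).2 fun t ht => ?_
      rw [@Measure.restrict_apply X m _ _ _ ht]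
      exact (h1 _ (ht.inter hG) Set.inter_subset_right).trans (measure_mono Set.inter_subset_left)
    rw [e1, hlin a ha.measurable _ (hg.indicator hG), hlin p hp.measurable _ hg,
      @lintegral_indicator X m _ _ hG]
    refine (@lintegral_mono' X m _ _ hle _ _ le_rfl).trans ?_
    rw [@lintegral_smul_measure]
    rfl
  · have hGc : MeasurableSet[m] Gᶜ := hG.compl
    have h3 := h2 _ hGc subset_rfl
    rw [Measure.smul_apply, hβ, hα, hval a _ hGc, hval p _ hGc, hpb _ hGc,
      ← ofReal_integral_eq_lintegral_ofReal ha.integrable.integrableOn (ae_of_all _ ha.nonneg),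
      ← ofReal_integral_eq_lintegral_ofReal hb.integrable.integrableOn (ae_of_all _ hb.nonneg)]
      at h3
    have h4 : 2 * ∫ x in Gᶜ, b x ∂μ ≤ ∫ x in Gᶜ, a x ∂μ := by
      rw [← ENNReal.ofReal_le_ofReal_iff (integral_nonneg ha.nonneg),
        ENNReal.ofReal_mul (by norm_num)]
      convert h3 using 1
      rw [ENNReal.smul_def, smul_eq_mul]
      norm_num
    have hI := integrable_sqrt_sub_sqrt_sq ha.integrable hb.integrable ha.nonneg hb.nonneg
    -- Pointwise `a ≤ (3/2) b + 3 (√a - √b)²`. Off `G` the mass of `b` is at most half that of `a`,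
    -- so the first term absorbs 3/4 of the left side; the remaining 1/4 yields the factor 12.
    have h5 : ∫ x in Gᶜ, a x ∂μ ≤
        ∫ x in Gᶜ, ((3 / 2) * b x + 3 * (√(a x) - √(b x)) ^ 2) ∂μ := by
      refine integral_mono ha.integrable.integrableOn
        ((hb.integrable.const_mul _).add (hI.const_mul _)).integrableOn fun x => ?_
      have e1 := Real.sq_sqrt (ha.nonneg x)
      have e2 := Real.sq_sqrt (hb.nonneg x)
      simp only
      nlinarith [sq_nonneg (2 * √(a x) - 3 * √(b x))]
    rw [integral_add (hb.integrable.const_mul _).integrableOn (hI.const_mul _).integrableOn,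
      integral_const_mul, integral_const_mul] at h5
    have h6 : ∫ x in Gᶜ, (√(a x) - √(b x)) ^ 2 ∂μ ≤ ∫ x, (√(a x) - √(b x)) ^ 2 ∂μ :=
      setIntegral_le_integral hI (ae_of_all _ fun _ => sq_nonneg _)
    linarith

end Domination

/-! ### One logarithmic factor tested against a nearly feasible density. -/

section Step

variable {X ι : Type*} {mX : MeasurableSpace X} {μ : Measure X}
  {𝓢 : ι → MeasurableSpace X} {j : ℕ → ι} {w : ℕ → X → ℝ} {p : X → ℝ}

/-- The main estimate: the integral of `log (w n)` against a density `a`, dominated by `p` on the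
σ-algebra of the update `n` and close to a density `b` with the same marginal as `p`. -/
theorem IsFeasible.integral_mul_log_le (h : IsScaling μ 𝓢 j w) (hp : IsFeasible μ 𝓢 j w p)
    (hfin : Integrable (fun x => p x * Real.log (p x)) μ) (n : ℕ) {a b : X → ℝ}
    (ha : Measurable a) (ha0 : ∀ x, 0 ≤ a x) (hai : Integrable a μ) (hb : IsDensity μ b)
    (hpb : MarginalEq μ (𝓢 (j n)) p b) (hap : MarginalDominated μ (𝓢 (j n)) a p) :
    Integrable (fun x => a x * Real.log (w n x)) μ ∧
      ∫ x, a x * Real.log (w n x) ∂μ ≤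
        17 * stepEntropy μ w n + (1 / 2) * ∫ x, (√(a x) - √(b x)) ^ 2 ∂μ := by
  have hle := h.le (j n)
  have hw := h.measurable n
  have hlog := (hp.integrable_mul_iterLog h hfin n).2
  have hinv := hp.integrable_mul_inv h n
  have hp0 := hp.density.nonneg
  have hpos := hp.ae_factor_pos h n
  have hlowm : Measurable[𝓢 (j n)] fun x => logLow (w n x) := measurable_logLow.comp hw
  have hhighm : Measurable[𝓢 (j n)] fun x => logHigh (w n x) := measurable_logHigh.comp hw
  have hsqm : Measurable[𝓢 (j n)] fun x => logLow (w n x) ^ 2 := hlowm.pow_const 2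
  have hbnd : Integrable (fun x => p x * (4 * (Real.log (w n x) - 1 + (w n x)⁻¹))) μ := by
    refine (((hlog.sub hp.density.integrable).add hinv.1).const_mul 4).congr
      (ae_of_all _ fun x => ?_)
    simp only [Pi.add_apply, Pi.sub_apply]
    ring
  -- The terms `-∫ p = -1` and `∫ p / w_n ≤ 1` cancel.
  have hbnd_le : ∫ x, p x * (4 * (Real.log (w n x) - 1 + (w n x)⁻¹)) ∂μ ≤
      4 * stepEntropy μ w n := by
    have e : ∀ x, p x * (4 * (Real.log (w n x) - 1 + (w n x)⁻¹)) =
        4 * ((p x * Real.log (w n x) - p x) + p x * (w n x)⁻¹) := fun x => by ring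
    have hs : Integrable (fun x => p x * Real.log (w n x) - p x) μ :=
      hlog.sub hp.density.integrable
    simp only [e]
    rw [integral_const_mul, integral_add hs hinv.1, integral_sub hlog hp.density.integrable, hp.density.integral_eq_one, hp.stepEntropy_eq h]
    linarith [hinv.2]
  have hlow : Integrable (fun x => p x * logLow (w n x)) μ := by
    refine hlog.abs.mono' (hp.density.measurable.mul
      (hlowm.mono hle le_rfl)).aestronglyMeasurable (ae_of_all _ fun x => ?_)
    rw [Real.norm_eq_abs, abs_mul, abs_mul]
    exact mul_le_mul_of_nonneg_left (abs_logLow_le _) (abs_nonneg _)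
  have hhigh : Integrable (fun x => p x * logHigh (w n x)) μ := by
    refine hlog.abs.mono' (hp.density.measurable.mul
      (hhighm.mono hle le_rfl)).aestronglyMeasurable (ae_of_all _ fun x => ?_)
    rw [Real.norm_of_nonneg (mul_nonneg (hp0 x) (logHigh_nonneg _)), abs_mul,
      abs_of_nonneg (hp0 x)]
    exact mul_le_mul_of_nonneg_left (logHigh_le_abs _) (hp0 x)
  have hsq_ae : ∀ᵐ x ∂μ, p x * logLow (w n x) ^ 2 ≤
      p x * (4 * (Real.log (w n x) - 1 + (w n x)⁻¹)) := by
    filter_upwards [hpos] with x hx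
    rcases (hp0 x).eq_or_lt with h0 | h0
    · simp [← h0]
    · exact mul_le_mul_of_nonneg_left (logLow_sq_le (hx h0)) h0.le
  have hhigh_ae : ∀ᵐ x ∂μ, p x * logHigh (w n x) ≤
      p x * (4 * (Real.log (w n x) - 1 + (w n x)⁻¹)) := by
    filter_upwards [hpos] with x hx
    rcases (hp0 x).eq_or_lt with h0 | h0
    · simp [← h0]
    · exact mul_le_mul_of_nonneg_left (logHigh_le (hx h0)) h0.le
  have hsq : Integrable (fun x => p x * logLow (w n x) ^ 2) μ := by
    refine hbnd.mono' (hp.density.measurable.mul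
      (hsqm.mono hle le_rfl)).aestronglyMeasurable ?_
    filter_upwards [hsq_ae] with x hx
    rwa [Real.norm_of_nonneg (mul_nonneg (hp0 x) (sq_nonneg _))]
  have hsq_le := (integral_mono_ae hsq hbnd hsq_ae).trans hbnd_le
  have hhigh_le := (integral_mono_ae hhigh hbnd hhigh_ae).trans hbnd_le
  have alow := hap.integrable_mul hle ha ha0 hp0 hlowm hlow
  have ahigh := hap.integrable_mul hle ha ha0 hp0 hhighm hhigh
  have asq := hap.integrable_mul hle ha ha0 hp0 hsqm hsq
  have blow := hpb.integrable_mul hle hp.density hb hlowm hlow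
  have bsq := hpb.integrable_mul hle hp.density hb hsqm hsq
  have asq_le := hap.integral_mul_le hle ha ha0 hp0 hsqm (fun _ => sq_nonneg _) hsq
  have ahigh_le := hap.integral_mul_le hle ha ha0 hp0 hhighm (fun _ => logHigh_nonneg _) hhigh
  have e1 := hpb.integral_mul hle hp.density hb hlowm
  have e2 := hpb.integral_mul hle hp.density hb hsqm
  have hI := integrable_sqrt_sub_sqrt_sq hai hb.integrable ha0 hb.nonneg
  -- With `u = √a`, `v = √b`, `t = logLow (w n)`: `(u² - v²) t = (u - v) · t (u + v)`, then Young's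
  -- inequality and `(u + v)² ≤ 2 (u² + v²)`.
  have hyoung : ∫ x, (a x * logLow (w n x) - b x * logLow (w n x)) ∂μ ≤
      ∫ x, ((1 / 2) * (√(a x) - √(b x)) ^ 2 +
        (a x * logLow (w n x) ^ 2 + b x * logLow (w n x) ^ 2)) ∂μ := by
    refine integral_mono (alow.sub blow) ((hI.const_mul _).add (asq.add bsq)) fun x => ?_
    have f1 := Real.sq_sqrt (ha0 x)
    have f2 := Real.sq_sqrt (hb.nonneg x)
    simp only
    generalize logLow (w n x) = t
    rw [← f1, ← f2, Real.sqrt_sq (Real.sqrt_nonneg _), Real.sqrt_sq (Real.sqrt_nonneg _)]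
    generalize √(a x) = u
    generalize √(b x) = v
    nlinarith [sq_nonneg ((u - v) - t * (u + v)), sq_nonneg (t * (u - v))]
  have hs : Integrable (fun x => a x * logLow (w n x) ^ 2 + b x * logLow (w n x) ^ 2) μ :=
    asq.add bsq
  rw [integral_sub alow blow, integral_add (hI.const_mul _) hs,
    integral_const_mul, integral_add asq bsq] at hyoung
  have hsplit : ∀ c : X → ℝ, (fun x => c x * Real.log (w n x)) =
      fun x => c x * logLow (w n x) + c x * logHigh (w n x) := fun c => by
    funext x
    rw [← mul_add, logLow_add_logHigh]
  have hκ : stepEntropy μ w n =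
      ∫ x, p x * logLow (w n x) ∂μ + ∫ x, p x * logHigh (w n x) ∂μ := by
    rw [hp.stepEntropy_eq h, hsplit p, integral_add hlow hhigh]
  rw [hsplit a]
  refine ⟨alow.add ahigh, ?_⟩
  rw [integral_add alow ahigh]
  -- 17 = 1 + 8 + 4 + 4: the main term, the squares of `logLow` against `a` (doubled by domination)
  -- and against `b`, and the excess of `logHigh` caused by the factor 2.
  linarith

end Step

/-! ### Nearly feasible late iterates and the Cauchy property. -/

section Truncation

variable {X ι : Type*} {mX : MeasurableSpace X} {μ : Measure X}
  {𝓢 : ι → MeasurableSpace X} {j : ℕ → ι} {w : ℕ → X → ℝ} {p : X → ℝ}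

/-- The square root of the density of the `n`-th iterate, in `L²`. -/
noncomputable def IsScaling.root (h : IsScaling μ 𝓢 j w) (n : ℕ) : Lp ℝ 2 μ :=
  sqrtLp (h.density n).integrable (h.density n).nonneg

/-- The total relative entropy of the steps `n, …, n + k - 1`. -/
noncomputable def windowEntropy (μ : Measure X) (w : ℕ → X → ℝ) (k n : ℕ) : ℝ :=
  ∑ l ∈ Finset.Ico n (n + k), stepEntropy μ w l

/-- Triangle inequality in `L²` over at most `k` steps, then Cauchy-Schwarz. -/
theorem IsFeasible.hellinger_window_le (h : IsScaling μ 𝓢 j w) (hp : IsFeasible μ 𝓢 j w p)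
    (hfin : Integrable (fun x => p x * Real.log (p x)) μ) {k n m : ℕ} (hnm : n ≤ m)
    (hmk : m ≤ n + k) :
    ∫ x, (√(iterDensity w (n + k) x) - √(iterDensity w m x)) ^ 2 ∂μ ≤
      k * windowEntropy μ w k n := by
  have hstep : ∀ l, ‖h.root (l + 1) - h.root l‖ ^ 2 ≤ stepEntropy μ w l := fun l => by
    unfold IsScaling.root
    rw [norm_sqrtLp_sub_sq]
    exact hp.hellinger_step_le h hfin l
  have hκ := hp.stepEntropy_nonneg h hfin
  rw [← norm_sqrtLp_sub_sq (h.density _).integrable (h.density _).integrable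
    (h.density _).nonneg (h.density _).nonneg]
  change ‖h.root (n + k) - h.root m‖ ^ 2 ≤ _
  have h1 : ‖h.root (n + k) - h.root m‖ ≤
      ∑ l ∈ Finset.Ico m (n + k), ‖h.root (l + 1) - h.root l‖ := by
    have := dist_le_Ico_sum_dist h.root hmk
    simp only [dist_eq_norm] at this
    rw [norm_sub_rev]
    exact this.trans_eq (Finset.sum_congr rfl fun l _ => norm_sub_rev _ _)
  have hcard : ((Finset.Ico m (n + k)).card : ℝ) ≤ k := by
    rw [Nat.card_Ico]
    exact_mod_cast (by omega)
  calc ‖h.root (n + k) - h.root m‖ ^ 2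
      ≤ (∑ l ∈ Finset.Ico m (n + k), ‖h.root (l + 1) - h.root l‖) ^ 2 := by gcongr
    _ ≤ (Finset.Ico m (n + k)).card *
        ∑ l ∈ Finset.Ico m (n + k), ‖h.root (l + 1) - h.root l‖ ^ 2 := sq_sum_le_card_mul_sum_sq
    _ ≤ k * ∑ l ∈ Finset.Ico m (n + k), stepEntropy μ w l := by
        gcongr with l hl
        exact hstep l
    _ ≤ k * windowEntropy μ w k n := by
        unfold windowEntropy
        exact mul_le_mul_of_nonneg_left (Finset.sum_le_sum_of_subset_of_nonneg
          (Finset.Ico_subset_Ico_left hnm) fun l _ _ => hκ l) k.cast_nonneg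

/-- The Hellinger distance between a density and its restriction to a set. -/
theorem integral_sqrt_indicator_sub_sq {a : X → ℝ} (ha : IsDensity μ a) {G : Set X}
    (hG : MeasurableSet G) :
    ∫ x, (√(G.indicator a x) - √(a x)) ^ 2 ∂μ = ∫ x in Gᶜ, a x ∂μ := by
  rw [← integral_indicator hG.compl]
  refine integral_congr_ae (ae_of_all _ fun x => ?_)
  by_cases hx : x ∈ G
  · simp [hx]
  · simp [hx, Real.sq_sqrt (ha.nonneg x)]

/-- The window sums are summable in `n`, being sums of `k` shifts of `κ`. If they stayed above `ε /
(n + k)`, the harmonic series would converge. -/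
theorem exists_mul_window_lt {κ : ℕ → ℝ} (hs : Summable κ) (k : ℕ)
    {ε : ℝ} (hε : 0 < ε) (n₀ : ℕ) :
    ∃ n, n₀ ≤ n ∧ ((n + k : ℕ) : ℝ) * ∑ l ∈ Finset.Ico n (n + k), κ l < ε := by
  by_contra! hcon
  have hs1 : Summable fun n => ∑ l ∈ Finset.Ico n (n + k), κ l := by
    simp only [Finset.sum_Ico_eq_sum_range, Nat.add_sub_cancel_left]
    refine summable_sum fun i _ => ?_
    exact (summable_nat_add_iff i).2 hs
  have hs2 : Summable fun n : ℕ => ε * (1 / ((n + (n₀ + k + 1) : ℕ) : ℝ)) := by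
    refine Summable.of_nonneg_of_le (fun n => by positivity) (fun n => ?_)
      ((summable_nat_add_iff (n₀ + 1)).2 hs1)
    have := hcon (n + (n₀ + 1)) (by omega)
    rw [mul_one_div, div_le_iff₀ (by positivity), mul_comm]
    rwa [show n + (n₀ + k + 1) = n + (n₀ + 1) + k by ring]
  rw [summable_mul_left_iff hε.ne'] at hs2
  exact Real.not_summable_one_div_natCast
    ((summable_nat_add_iff (f := fun n : ℕ => 1 / (n : ℝ)) (n₀ + k + 1)).1 hs2)

/-- The truncated iterates are close to the previous iterates in the Hellinger distance. -/
theorem IsScaling.hellinger_truncation_le (h : IsScaling μ 𝓢 j w) {N l : ℕ} (hl : l ≤ N)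
    {G : Set X} (hG : MeasurableSet G)
    (hi : Integrable (fun x => G.indicator (iterDensity w N) x *
      (iterLog w N x - iterLog w l x)) μ) :
    ∫ x, (√(G.indicator (iterDensity w N) x) - √(iterDensity w l x)) ^ 2 ∂μ ≤
      ∫ x, G.indicator (iterDensity w N) x * (iterLog w N x - iterLog w l x) ∂μ +
        ∫ x in Gᶜ, iterDensity w N x ∂μ := by
  have hd := h.density N
  have := integral_sqrt_sub_sqrt_sq_le (hd.integrable.indicator hG) (h.density l).integrable
    (Set.indicator_nonneg fun x _ => hd.nonneg x) (h.density l).nonneg hi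
    (ae_of_all _ fun x hx => by
      have hxG : x ∈ G := by
        by_contra hc
        rw [Set.indicator_of_notMem hc] at hx
        exact hx.false
      rw [Set.indicator_of_mem hxG] at hx ⊢
      have h1 := h.iterDensity_pos_of_le hx hl
      exact ⟨h1, by rw [h.log_iterDensity hx, h.log_iterDensity h1]⟩)
  rw [(h.density l).integral_eq_one, integral_indicator hG] at this
  have h2 := integral_add_compl hG hd.integrable
  rw [hd.integral_eq_one] at h2
  linarith

variable [Fintype ι]

/-- After a full cycle, the iterate can be truncated, at a small loss of mass, so that the
logarithms of all factors are controlled. -/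
theorem IsFeasible.exists_truncation (h : IsScaling μ 𝓢 j w) (hp : IsFeasible μ 𝓢 j w p)
    (hfin : Integrable (fun x => p x * Real.log (p x)) μ) {k : ℕ}
    (hk : ∀ i n, ∃ m, n ≤ m ∧ m < n + k ∧ j m = i) (n : ℕ) :
    ∃ G, MeasurableSet G ∧
      ∫ x in Gᶜ, iterDensity w (n + k) x ∂μ ≤
        12 * Fintype.card ι * (k * windowEntropy μ w k n) ∧
      ∀ m, Integrable (fun x => G.indicator (iterDensity w (n + k)) x * Real.log (w m x)) μ ∧
        ∫ x, G.indicator (iterDensity w (n + k)) x * Real.log (w m x) ∂μ ≤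
          17 * stepEntropy μ w m +
            (12 * Fintype.card ι + 1) * (k * windowEntropy μ w k n) := by
  set f := iterDensity w (n + k) with hf
  set η := k * windowEntropy μ w k n with hη
  have hd := h.density (n + k)
  -- `m i` is a step of the cycle that enforces constraint `i`; the iterate right after it has the
  -- marginal of `p` on `𝓢 i` and is close to `f`.
  choose m hm1 hm2 hm3 using fun i => hk i n
  have hwin : ∀ i, ∫ x, (√(f x) - √(iterDensity w (m i + 1) x)) ^ 2 ∂μ ≤ η := fun i =>
    hp.hellinger_window_le h hfin (by have := hm1 i; omega) (hm2 i)
  have hmarg : ∀ i, MarginalEq μ (𝓢 i) p (iterDensity w (m i + 1)) := fun i => by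
    have := hp.marginal (m i)
    rwa [hm3 i] at this
  choose G hG hdom hmass using fun i => exists_dominated_set (h.le i) hd hp.density
  have hGm : MeasurableSet (⋂ i, G i) := MeasurableSet.iInter fun i => h.le i _ (hG i)
  have hmass' : ∫ x in (⋂ i, G i)ᶜ, f x ∂μ ≤ 12 * Fintype.card ι * η := by
    rw [Set.compl_iInter]
    calc ∫ x in ⋃ i, (G i)ᶜ, f x ∂μ ≤ ∑ i, ∫ x in (G i)ᶜ, f x ∂μ := by
          rw [← integral_indicator (MeasurableSet.iUnion fun i => (h.le i _ (hG i)).compl)]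
          have e : ∀ i, ∫ x in (G i)ᶜ, f x ∂μ = ∫ x, (G i)ᶜ.indicator f x ∂μ := fun i =>
            (integral_indicator (h.le i _ (hG i)).compl).symm
          simp only [e]
          have hint : ∀ i, Integrable ((G i)ᶜ.indicator f) μ := fun i =>
            hd.integrable.indicator (h.le i _ (hG i)).compl
          rw [← integral_finsetSum _ fun i _ => hint i]
          refine integral_mono (hd.integrable.indicator
            (MeasurableSet.iUnion fun i => (h.le i _ (hG i)).compl))
            (integrable_finsetSum _ fun i _ => hint i) fun x => ?_
          have hnn : ∀ i ∈ Finset.univ, 0 ≤ (G i)ᶜ.indicator f x := fun i _ =>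
            Set.indicator_nonneg (fun x _ => hd.nonneg x) x
          by_cases hx : x ∈ ⋃ i, (G i)ᶜ
          · obtain ⟨i, hi⟩ := Set.mem_iUnion.1 hx
            rw [Set.indicator_of_mem hx, ← Set.indicator_of_mem hi f]
            exact Finset.single_le_sum hnn (Finset.mem_univ i)
          · rw [Set.indicator_of_notMem hx]
            exact Finset.sum_nonneg hnn
      _ ≤ ∑ _i : ι, 12 * η := Finset.sum_le_sum fun i _ =>
          (hmass i _ (h.density _) (hmarg i)).trans (by gcongr; exact hwin i)
      _ = 12 * Fintype.card ι * η := by simp; ring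
  refine ⟨⋂ i, G i, hGm, hmass', fun l => ?_⟩
  have ha0 : ∀ x, 0 ≤ (⋂ i, G i).indicator f x := Set.indicator_nonneg fun x _ => hd.nonneg x
  have hai : Integrable ((⋂ i, G i).indicator f) μ := hd.integrable.indicator hGm
  have hdom' : MarginalDominated μ (𝓢 (j l)) ((⋂ i, G i).indicator f) p :=
    (hdom (j l)).mono fun x =>
      Set.indicator_le_indicator_of_subset (Set.iInter_subset _ _) (fun x => hd.nonneg x) x
  obtain ⟨h1, h2⟩ := hp.integral_mul_log_le h hfin l (hd.measurable.indicator hGm) ha0 hai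
    (h.density _) (hmarg (j l)) hdom'
  refine ⟨h1, h2.trans ?_⟩
  have hb := h.density (m (j l) + 1)
  have hI1 := integrable_sqrt_sub_sqrt_sq hai hd.integrable ha0 hd.nonneg
  have hI2 := integrable_sqrt_sub_sqrt_sq hd.integrable hb.integrable hd.nonneg hb.nonneg
  -- From `(x + y)² ≤ 2x² + 2y²`, through `√f`. Half of the result is the lost mass plus `η`, hence
  -- the coefficient `12 * Fintype.card ι + 1`.
  have h3 := integral_mono (integrable_sqrt_sub_sqrt_sq hai hb.integrable ha0 hb.nonneg)
    ((hI1.const_mul 2).add (hI2.const_mul 2)) (fun x => by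
      simp only [Pi.add_apply]
      nlinarith [sq_nonneg ((√((⋂ i, G i).indicator f x) - √(f x)) -
        (√(f x) - √(iterDensity w (m (j l) + 1) x)))])
  simp only [Pi.add_apply] at h3
  rw [integral_add (hI1.const_mul 2) (hI2.const_mul 2), integral_const_mul, integral_const_mul,
    integral_sqrt_indicator_sub_sq hd hGm] at h3
  have h4 := hwin (j l)
  linarith

/-- Arbitrarily late iterates have truncations of almost full mass whose relative entropy with
respect to all previous iterates is controlled. -/
theorem IsFeasible.exists_truncation_small (h : IsScaling μ 𝓢 j w) (hp : IsFeasible μ 𝓢 j w p)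
    (hfin : Integrable (fun x => p x * Real.log (p x)) μ) {k : ℕ}
    (hk : ∀ i n, ∃ m, n ≤ m ∧ m < n + k ∧ j m = i) {ε : ℝ} (hε : 0 < ε) (n₀ : ℕ) :
    ∃ N, n₀ ≤ N ∧ ∃ G, MeasurableSet G ∧ ∫ x in Gᶜ, iterDensity w N x ∂μ ≤ ε ∧
      ∀ l ≤ N, Integrable (fun x => G.indicator (iterDensity w N) x *
          (iterLog w N x - iterLog w l x)) μ ∧
        ∫ x, G.indicator (iterDensity w N) x * (iterLog w N x - iterLog w l x) ∂μ ≤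
          17 * (∑' m, stepEntropy μ w m - ∑ m ∈ Finset.range l, stepEntropy μ w m) + ε := by
  have hκ := hp.stepEntropy_nonneg h hfin
  have hs := hp.summable_stepEntropy h hfin
  set C : ℝ := (12 * Fintype.card ι + 1) * k + 1 with hC
  have hC0 : 0 < C := by positivity
  -- Starting at `n₀ + 1` makes `n + k ≥ 1`, so that smallness of `(n + k) η` also gives smallness
  -- of the lost mass, of order `η`.
  obtain ⟨n, hn, hlt⟩ := exists_mul_window_lt hs k (div_pos hε hC0) (n₀ + 1)
  rw [lt_div_iff₀ hC0] at hlt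
  change _ * windowEntropy μ w k n * C < ε at hlt
  obtain ⟨G, hG, hmass, hlog⟩ := hp.exists_truncation h hfin hk n
  have hη : 0 ≤ windowEntropy μ w k n := Finset.sum_nonneg fun l _ => hκ l
  have hN1 : (1 : ℝ) ≤ ((n + k : ℕ) : ℝ) := by exact_mod_cast (by omega)
  have hbig : ((n + k : ℕ) : ℝ) *
      ((12 * Fintype.card ι + 1) * (k * windowEntropy μ w k n)) ≤ ε := by
    refine le_trans ?_ hlt.le
    have : 0 ≤ ((n + k : ℕ) : ℝ) * windowEntropy μ w k n := by positivity
    rw [hC]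
    nlinarith
  refine ⟨n + k, by omega, G, hG, ?_, fun l hl => ?_⟩
  · refine hmass.trans (le_trans ?_ hbig)
    have h1 : 0 ≤ k * windowEntropy μ w k n := by positivity
    have h2 : 0 ≤ (12 * Fintype.card ι + 1) * (k * windowEntropy μ w k n) := by positivity
    nlinarith
  · have e : ∀ x, G.indicator (iterDensity w (n + k)) x *
        (iterLog w (n + k) x - iterLog w l x) =
        ∑ m ∈ Finset.Ico l (n + k),
          G.indicator (iterDensity w (n + k)) x * Real.log (w m x) := fun x => by
      rw [← Finset.mul_sum, Finset.sum_Ico_eq_sub _ hl]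
      rfl
    simp only [e]
    refine ⟨integrable_finsetSum _ fun m _ => (hlog m).1, ?_⟩
    rw [integral_finsetSum _ fun m _ => (hlog m).1]
    calc _ ≤ ∑ m ∈ Finset.Ico l (n + k), (17 * stepEntropy μ w m +
            (12 * Fintype.card ι + 1) * (k * windowEntropy μ w k n)) :=
          Finset.sum_le_sum fun m _ => (hlog m).2
      _ = 17 * (∑ m ∈ Finset.range (n + k), stepEntropy μ w m -
            ∑ m ∈ Finset.range l, stepEntropy μ w m) +
            ((n + k - l : ℕ) : ℝ) *
            ((12 * Fintype.card ι + 1) * (k * windowEntropy μ w k n)) := by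
          rw [Finset.sum_add_distrib, ← Finset.mul_sum, Finset.sum_Ico_eq_sub _ hl]
          simp
      _ ≤ _ := by
          have h1 := hs.sum_le_tsum (Finset.range (n + k)) fun m _ => hκ m
          have h2 : ((n + k - l : ℕ) : ℝ) *
              ((12 * Fintype.card ι + 1) * (k * windowEntropy μ w k n)) ≤ ε := by
            refine le_trans ?_ hbig
            gcongr
            omega
          linarith

/-- The square roots of the densities of the iterates form a Cauchy sequence in `L²`. -/
theorem IsFeasible.cauchySeq_root (h : IsScaling μ 𝓢 j w) (hp : IsFeasible μ 𝓢 j w p)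
    (hfin : Integrable (fun x => p x * Real.log (p x)) μ) {k : ℕ}
    (hk : ∀ i n, ∃ m, n ≤ m ∧ m < n + k ∧ j m = i) : CauchySeq h.root := by
  have hκ := hp.stepEntropy_nonneg h hfin
  have hs := hp.summable_stepEntropy h hfin
  refine Metric.cauchySeq_iff.2 fun δ hδ => ?_
  obtain ⟨τ, hτ, hτδ⟩ : ∃ τ : ℝ, 0 < τ ∧ 160 * τ < δ ^ 2 :=
    ⟨δ ^ 2 / 161, by positivity, by have := pow_pos hδ 2; linarith⟩
  obtain ⟨l₀, hl₀⟩ := (Metric.tendsto_atTop.1 hs.hasSum.tendsto_sum_nat) τ hτ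
  have hS : ∀ l, l₀ ≤ l →
      ∑' m, stepEntropy μ w m - ∑ m ∈ Finset.range l, stepEntropy μ w m ≤ τ := fun l hl => by
    have := hl₀ l hl
    rw [dist_comm, Real.dist_eq] at this
    exact (le_abs_self _).trans this.le
  refine ⟨l₀, fun m hm n hn => ?_⟩
  -- One later truncated iterate `r` serves as a common comparison point for `m` and `n`. Each
  -- squared distance to it is at most 19τ, so the squared distance between the two roots is at most
  -- 76τ.
  obtain ⟨N, hN, G, hG, hmass, hlog⟩ := hp.exists_truncation_small h hfin hk hτ (max m n)
  have hd := h.density N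
  have ha0 : ∀ x, 0 ≤ G.indicator (iterDensity w N) x :=
    Set.indicator_nonneg fun x _ => hd.nonneg x
  set r := sqrtLp (hd.integrable.indicator hG) ha0
  have h1 : ∀ l, l ≤ N → l₀ ≤ l → ‖r - h.root l‖ ^ 2 ≤ 19 * τ := fun l hl hl' => by
    unfold IsScaling.root
    rw [norm_sqrtLp_sub_sq]
    have := h.hellinger_truncation_le hl hG (hlog l hl).1
    have := (hlog l hl).2
    have := hS l hl'
    linarith
  have h2 := h1 m ((le_max_left _ _).trans hN) hm
  have h3 := h1 n ((le_max_right _ _).trans hN) hn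
  have h4 : ‖h.root m - h.root n‖ ≤ ‖r - h.root m‖ + ‖r - h.root n‖ := by
    rw [norm_sub_rev r (h.root m)]
    exact norm_sub_le_norm_sub_add_norm_sub _ _ _
  rw [dist_eq_norm]
  refine lt_of_pow_lt_pow_left₀ 2 hδ.le ?_
  nlinarith [norm_nonneg (h.root m - h.root n), sq_nonneg (‖r - h.root m‖ - ‖r - h.root n‖)]

end Truncation

/-! ### Feasibility and minimality of the limit density. -/

section Limit

variable {X ι : Type*} {mX : MeasurableSpace X} {μ : Measure X}
  {𝓢 : ι → MeasurableSpace X} {j : ℕ → ι} {w : ℕ → X → ℝ} {p q : X → ℝ}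

/-- If the square roots of probability densities converge in `L²`, the limit is the square root
of a probability density. -/
theorem exists_density_of_tendsto {f : ℕ → X → ℝ} (hf : ∀ n, IsDensity μ (f n)) {s : Lp ℝ 2 μ}
    (hs : Tendsto (fun n => sqrtLp (hf n).integrable (hf n).nonneg) atTop (𝓝 s)) :
    ∃ q, IsDensity μ q ∧
      Tendsto (fun n => ∫ x, (√(f n x) - √(q x)) ^ 2 ∂μ) atTop (𝓝 0) := by
  have hsm : Measurable s := (Lp.stronglyMeasurable s).measurable
  have hint : Integrable (fun x => s x ^ 2) μ :=
    (memLp_two_iff_integrable_sq (Lp.aestronglyMeasurable s)).1 (Lp.memLp s)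
  have hnorm : ‖s‖ ^ 2 = 1 := by
    refine tendsto_nhds_unique (hs.norm.pow 2) ?_
    simp only [norm_sqrtLp_sq, (hf _).integral_eq_one]
    exact tendsto_const_nhds
  have hq : IsDensity μ fun x => s x ^ 2 :=
    ⟨hsm.pow_const 2, fun x => sq_nonneg _, hint, by rw [← norm_sq_Lp_two, hnorm]⟩
  refine ⟨_, hq, ?_⟩
  have h0 : Tendsto (fun n => ‖sqrtLp (hf n).integrable (hf n).nonneg - s‖ ^ 2) atTop (𝓝 0) := by
    simpa using ((hs.sub_const s).norm.pow 2)
  refine squeeze_zero (fun n => integral_nonneg fun x => sq_nonneg _) (fun n => ?_) h0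
  rw [norm_sq_Lp_two]
  have hI := (memLp_two_iff_integrable_sq (Lp.aestronglyMeasurable _)).1
    (Lp.memLp (sqrtLp (hf n).integrable (hf n).nonneg - s))
  refine integral_mono_ae (integrable_sqrt_sub_sqrt_sq (hf n).integrable hq.integrable
    (hf n).nonneg hq.nonneg) hI ?_
  filter_upwards [Lp.coeFn_sub (sqrtLp (hf n).integrable (hf n).nonneg) s,
    coeFn_sqrtLp (hf n).integrable (hf n).nonneg] with x h1 h2
  rw [h1, Pi.sub_apply, h2, Real.sqrt_sq_eq_abs]
  -- The sign of `s` is not known, so `√(s²)` is `|s|`; passing to absolute values does not increase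
  -- the distance to `√(f n)`.
  have h3 := abs_abs_sub_abs_le (√(f n x)) (s x)
  rw [abs_of_nonneg (Real.sqrt_nonneg (f n x))] at h3
  exact sq_le_sq.2 h3

/-- Hellinger convergence implies convergence of the probabilities of events, uniformly. -/
theorem abs_setIntegral_sub_le {a b : X → ℝ} (ha : IsDensity μ a) (hb : IsDensity μ b)
    (A : Set X) :
    |∫ x in A, a x ∂μ - ∫ x in A, b x ∂μ| ≤ 2 * √(∫ x, (√(a x) - √(b x)) ^ 2 ∂μ) := by
  rw [← integral_sub ha.integrable.integrableOn hb.integrable.integrableOn]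
  refine abs_integral_le_integral_abs.trans (le_trans ?_ (integral_abs_sub_le ha hb))
  exact setIntegral_le_integral (ha.integrable.sub hb.integrable).abs
    (ae_of_all _ fun x => abs_nonneg _)

theorem IsDensity.setLIntegral {a : X → ℝ} (ha : IsDensity μ a) (A : Set X) :
    ∫⁻ x in A, ENNReal.ofReal (a x) ∂μ = ENNReal.ofReal (∫ x in A, a x ∂μ) :=
  (ofReal_integral_eq_lintegral_ofReal ha.integrable.integrableOn (ae_of_all _ ha.nonneg)).symm

/-- The Hellinger limit of the iterates is feasible. -/
theorem IsFeasible.of_tendsto (h : IsScaling μ 𝓢 j w) (hp : IsFeasible μ 𝓢 j w p) {k : ℕ}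
    (hk : ∀ i n, ∃ m, n ≤ m ∧ m < n + k ∧ j m = i) (hq : IsDensity μ q)
    (hlim : Tendsto (fun n => ∫ x, (√(iterDensity w n x) - √(q x)) ^ 2 ∂μ) atTop (𝓝 0)) :
    IsFeasible μ 𝓢 j w q := by
  refine ⟨hq, fun n A hA => ?_⟩
  refine Eq.trans ?_ (hp.marginal n A hA)
  rw [hq.setLIntegral, hp.density.setLIntegral]
  congr 1
  have hlim' : Tendsto (fun n => ∫ x in A, iterDensity w n x ∂μ) atTop
      (𝓝 (∫ x in A, q x ∂μ)) := by
    rw [tendsto_iff_dist_tendsto_zero]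
    refine squeeze_zero (fun n => dist_nonneg)
      (fun n => abs_setIntegral_sub_le (h.density n) hq A) ?_
    simpa using (hlim.sqrt.const_mul 2)
  -- Constraint `j n` is enforced infinitely often; along those steps the mass of `A` is constantly
  -- that under `p`.
  choose m hm1 hm2 hm3 using hk (j n)
  have hmt : Tendsto (fun n => m n + 1) atTop atTop :=
    tendsto_atTop_mono (fun n => (hm1 n).trans (m n).le_succ) tendsto_id
  refine tendsto_nhds_unique (hlim'.comp hmt) ?_
  refine tendsto_const_nhds.congr fun l => ?_
  have := hp.marginal (m l) A (by rwa [hm3])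
  rw [hp.density.setLIntegral, (h.density _).setLIntegral, ENNReal.ofReal_eq_ofReal_iff
    (integral_nonneg hp.density.nonneg) (integral_nonneg (h.density _).nonneg)] at this
  exact this

variable [Fintype ι]

/-- Lower semicontinuity: the relative entropy of the limit with respect to the `l`-th iterate is
controlled by the entropies of the remaining steps. -/
theorem IsFeasible.lintegral_limit_le (h : IsScaling μ 𝓢 j w) (hp : IsFeasible μ 𝓢 j w p)
    (hfin : Integrable (fun x => p x * Real.log (p x)) μ) {k : ℕ}
    (hk : ∀ i n, ∃ m, n ≤ m ∧ m < n + k ∧ j m = i) (hq : IsDensity μ q)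
    (hlim : Tendsto (fun n => ∫ x, (√(iterDensity w n x) - √(q x)) ^ 2 ∂μ) atTop (𝓝 0))
    (l : ℕ) :
    (∀ᵐ x ∂μ, 0 ≤ q x * Real.log (q x) - q x * iterLog w l x - q x + iterDensity w l x) ∧
    ∫⁻ x, ENNReal.ofReal
        (q x * Real.log (q x) - q x * iterLog w l x - q x + iterDensity w l x) ∂μ ≤
      ENNReal.ofReal
        (17 * (∑' m, stepEntropy μ w m - ∑ m ∈ Finset.range l, stepEntropy μ w m)) := by
  choose N hN G hG hmass hlog using fun i : ℕ =>
    hp.exists_truncation_small h hfin hk (Nat.one_div_pos_of_nat (α := ℝ) (n := i)) (max i l)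
  set a : ℕ → X → ℝ := fun i => (G i).indicator (iterDensity w (N i)) with ha
  have ha0 : ∀ i x, 0 ≤ a i x := fun i =>
    Set.indicator_nonneg fun x _ => (h.density (N i)).nonneg x
  have hai : ∀ i, Integrable (a i) μ := fun i => (h.density (N i)).integrable.indicator (hG i)
  have ham : ∀ i, Measurable (a i) := fun i => (h.density (N i)).measurable.indicator (hG i)
  have hlN : ∀ i, l ≤ N i := fun i => (le_max_right _ _).trans (hN i)
  have hNt : Tendsto N atTop atTop :=
    tendsto_atTop_mono (fun i => (le_max_left _ _).trans (hN i)) tendsto_id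
  have hε : Tendsto (fun i : ℕ => 1 / ((i : ℝ) + 1)) atTop (𝓝 0) :=
    tendsto_one_div_add_atTop_nhds_zero_nat
  have hconv : Tendsto (fun i => sqrtLp (hai i) (ha0 i)) atTop
      (𝓝 (sqrtLp hq.integrable hq.nonneg)) := by
    have h1 : Tendsto (fun i => ‖sqrtLp (hai i) (ha0 i) - h.root (N i)‖ ^ 2) atTop (𝓝 0) := by
      refine squeeze_zero (fun i => sq_nonneg _) (fun i => ?_) hε
      unfold IsScaling.root
      rw [norm_sqrtLp_sub_sq, integral_sqrt_indicator_sub_sq (h.density (N i)) (hG i)]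
      exact hmass i
    have h2 : Tendsto (fun i => ‖h.root (N i) - sqrtLp hq.integrable hq.nonneg‖ ^ 2) atTop
        (𝓝 0) := by
      unfold IsScaling.root
      simp only [norm_sqrtLp_sub_sq]
      exact hlim.comp hNt
    have h3 := (h1.sqrt.add h2.sqrt)
    simp only [Real.sqrt_sq (norm_nonneg _), Real.sqrt_zero, add_zero] at h3
    rw [tendsto_iff_norm_sub_tendsto_zero]
    exact squeeze_zero (fun _ => norm_nonneg _)
      (fun i => norm_sub_le_norm_sub_add_norm_sub _ _ _) h3
  obtain ⟨φ, hφ, hae⟩ := (tendstoInMeasure_of_tendsto_Lp hconv).exists_seq_tendsto_ae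
  have hae' : ∀ᵐ x ∂μ, Tendsto (fun i => a (φ i) x) atTop (𝓝 (q x)) := by
    filter_upwards [hae, ae_all_iff.2 fun i => coeFn_sqrtLp (hai i) (ha0 i),
      coeFn_sqrtLp hq.integrable hq.nonneg] with x h1 h2 h3
    rw [h3] at h1
    have := (h1.congr fun i => h2 (φ i)).pow 2
    rw [Real.sq_sqrt (hq.nonneg x)] at this
    exact this.congr fun i => Real.sq_sqrt (ha0 _ x)
  -- The integrand of KL(· | f_l). It is continuous in `t` even at 0, so a.e. convergence of the
  -- densities carries over and Fatou applies.
  set Ψ : X → ℝ → ℝ := fun x t =>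
    t * Real.log t - t * iterLog w l x - t + iterDensity w l x with hΨ
  have hΨc : ∀ x, Continuous (Ψ x) := fun x =>
    ((Real.continuous_mul_log.sub (continuous_id.mul continuous_const)).sub
      continuous_id).add continuous_const
  have hΨa : ∀ i x, Ψ x (a i x) =
      a i x * (iterLog w (N i) x - iterLog w l x) - a i x + iterDensity w l x := fun i x => by
    simp only [hΨ]
    rcases (ha0 i x).eq_or_lt with h0 | h0
    · simp [← h0]
    · have hxG : x ∈ G i := by
        by_contra hc
        simp only [ha, Set.indicator_of_notMem hc] at h0
        exact h0.false
      simp only [ha, Set.indicator_of_mem hxG] at h0 ⊢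
      rw [h.log_iterDensity h0]
      ring
  have hΨ0 : ∀ i x, 0 ≤ Ψ x (a i x) := fun i x => by
    rcases (ha0 i x).eq_or_lt with h0 | h0
    · simp [hΨ, ← h0, (h.density l).nonneg x]
    · have hxG : x ∈ G i := by
        by_contra hc
        simp only [ha, Set.indicator_of_notMem hc] at h0
        exact h0.false
      have h1 : 0 < iterDensity w l x := by
        simp only [ha, Set.indicator_of_mem hxG] at h0
        exact h.iterDensity_pos_of_le h0 (hlN i)
      have h2 := sqrt_sub_sqrt_sq_le h0 h1
      rw [h.log_iterDensity h1] at h2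
      simp only [hΨ]
      nlinarith [sq_nonneg (√(a i x) - √(iterDensity w l x))]
  have hΨm : ∀ c : X → ℝ, Measurable c → Measurable fun x => Ψ x (c x) := fun c hc =>
    (((hc.mul hc.log).sub (hc.mul (h.measurable_iterLog l))).sub hc).add
      (h.density l).measurable
  have hΨt : ∀ᵐ x ∂μ, Tendsto (fun i => Ψ x (a (φ i) x)) atTop (𝓝 (Ψ x (q x))) := by
    filter_upwards [hae'] with x hx
    exact ((hΨc x).tendsto _).comp hx
  -- One `1 / (i + 1)` comes from the entropy bound, the other from the missing mass `1 - ∫ a i`.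
  have hΨi : ∀ i, ∫⁻ x, ENNReal.ofReal (Ψ x (a i x)) ∂μ ≤ ENNReal.ofReal
      (17 * (∑' m, stepEntropy μ w m - ∑ m ∈ Finset.range l, stepEntropy μ w m) +
        2 * (1 / ((i : ℝ) + 1))) := fun i => by
    obtain ⟨hi1, hi2⟩ := hlog i l (hlN i)
    have hi3 : Integrable (fun x => a i x * (iterLog w (N i) x - iterLog w l x) - a i x) μ :=
      hi1.sub (hai i)
    have hi4 : Integrable (fun x => Ψ x (a i x)) μ := by
      simp only [hΨa]
      exact hi3.add (h.density l).integrable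
    rw [← ofReal_integral_eq_lintegral_ofReal hi4 (ae_of_all _ (hΨ0 i))]
    refine ENNReal.ofReal_le_ofReal ?_
    simp only [hΨa]
    rw [integral_add hi3 (h.density l).integrable, integral_sub hi1 (hai i),
      (h.density l).integral_eq_one, ha]
    simp only
    rw [integral_indicator (hG i)]
    have h2 := integral_add_compl (hG i) (h.density (N i)).integrable
    rw [(h.density (N i)).integral_eq_one] at h2
    have := hmass i
    linarith
  refine ⟨?_, ?_⟩
  · filter_upwards [hΨt] with x hx
    exact ge_of_tendsto' hx fun i => hΨ0 _ x
  calc ∫⁻ x, ENNReal.ofReal (Ψ x (q x)) ∂μ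
      = ∫⁻ x, liminf (fun i => ENNReal.ofReal (Ψ x (a (φ i) x))) atTop ∂μ := by
        refine lintegral_congr_ae ?_
        filter_upwards [hΨt] with x hx
        exact ((ENNReal.continuous_ofReal.tendsto _).comp hx).liminf_eq.symm
    _ ≤ liminf (fun i => ∫⁻ x, ENNReal.ofReal (Ψ x (a (φ i) x)) ∂μ) atTop :=
        lintegral_liminf_le fun i => (hΨm _ (ham _)).ennreal_ofReal
    _ ≤ liminf (fun i => ENNReal.ofReal
          (17 * (∑' m, stepEntropy μ w m - ∑ m ∈ Finset.range l, stepEntropy μ w m) +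
            2 * (1 / ((φ i : ℝ) + 1)))) atTop :=
        liminf_le_liminf (Eventually.of_forall fun i => hΨi (φ i))
    _ = _ := by
        refine Tendsto.liminf_eq ((ENNReal.continuous_ofReal.tendsto _).comp ?_)
        simpa using ((hε.comp hφ.tendsto_atTop).const_mul 2).const_add
          (17 * (∑' m, stepEntropy μ w m - ∑ m ∈ Finset.range l, stepEntropy μ w m))

/-- Convergence of iterative proportional fitting: the iterates converge in the Hellinger distance
to the feasible density of minimal relative entropy. -/
theorem IsFeasible.exists_minimizer (h : IsScaling μ 𝓢 j w) (hp : IsFeasible μ 𝓢 j w p)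
    (hfin : Integrable (fun x => p x * Real.log (p x)) μ) {k : ℕ}
    (hk : ∀ i n, ∃ m, n ≤ m ∧ m < n + k ∧ j m = i) :
    ∃ q, IsFeasible μ 𝓢 j w q ∧ Integrable (fun x => q x * Real.log (q x)) μ ∧
      Tendsto (fun n => ∫ x, (√(iterDensity w n x) - √(q x)) ^ 2 ∂μ) atTop (𝓝 0) ∧
      ∀ p', IsFeasible μ 𝓢 j w p' → Integrable (fun x => p' x * Real.log (p' x)) μ →
        ∫ x, q x * Real.log (q x) ∂μ ≤ ∫ x, p' x * Real.log (p' x) ∂μ ∧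
        (∫ x, p' x * Real.log (p' x) ∂μ ≤ ∫ x, q x * Real.log (q x) ∂μ → p' =ᵐ[μ] q) := by
  have hκ := hp.stepEntropy_nonneg h hfin
  have hs := hp.summable_stepEntropy h hfin
  obtain ⟨s, hs'⟩ := cauchySeq_tendsto_of_complete (hp.cauchySeq_root h hfin hk)
  obtain ⟨q, hq, hlim⟩ := exists_density_of_tendsto h.density hs'
  have hqf := hp.of_tendsto h hk hq hlim
  have hbd := hp.lintegral_limit_le h hfin hk hq hlim
  have hqfin : Integrable (fun x => q x * Real.log (q x)) μ := by
    -- At `l = 0` the iterate is 1 and `iterLog` is 0, leaving `q log q - q + 1`.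
    obtain ⟨h1, h2⟩ := hbd 0
    have h3 : Integrable (fun x => q x * Real.log (q x) - q x * iterLog w 0 x - q x +
        iterDensity w 0 x) μ := by
      refine (lintegral_ofReal_ne_top_iff_integrable (Measurable.aestronglyMeasurable ?_) h1).1
        (ne_top_of_le_ne_top ENNReal.ofReal_ne_top h2)
      exact (((hq.measurable.mul hq.measurable.log).sub
        (hq.measurable.mul (h.measurable_iterLog 0))).sub hq.measurable).add
          (h.density 0).measurable
    refine ((h3.add hq.integrable).sub (h.density 0).integrable).congr (ae_of_all _ fun x => ?_)
    simp only [Pi.add_apply, Pi.sub_apply, iterLog, Finset.range_zero, Finset.sum_empty]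
    ring
  set S := ∑' m, stepEntropy μ w m with hS
  have hub : ∫ x, q x * Real.log (q x) ∂μ ≤ S := by
    have h1 : ∀ l, ∫ x, q x * Real.log (q x) ∂μ ≤ ∑ m ∈ Finset.range l, stepEntropy μ w m +
        17 * (S - ∑ m ∈ Finset.range l, stepEntropy μ w m) := fun l => by
      obtain ⟨h1, h2⟩ := hbd l
      have hi := (hqf.integrable_mul_iterLog h hqfin l).1
      have i1 : Integrable (fun x => q x * Real.log (q x) - q x * iterLog w l x) μ :=
        hqfin.sub hi
      have i2 : Integrable (fun x => q x * Real.log (q x) - q x * iterLog w l x - q x) μ :=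
        i1.sub hq.integrable
      have i3 : Integrable (fun x => q x * Real.log (q x) - q x * iterLog w l x - q x +
          iterDensity w l x) μ := i2.add (h.density l).integrable
      rw [← ofReal_integral_eq_lintegral_ofReal i3 h1,
        ENNReal.ofReal_le_ofReal_iff, integral_add i2 (h.density l).integrable,
        integral_sub i1 hq.integrable, integral_sub hqfin hi, hq.integral_eq_one,
        (h.density l).integral_eq_one, hqf.integral_mul_iterLog h hqfin] at h2
      · linarith
      · have := hs.sum_le_tsum (Finset.range l) fun m _ => hκ m
        linarith
    have h2 := hs.hasSum.tendsto_sum_nat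
    have h3 := h2.add ((h2.const_sub S).const_mul 17)
    simp only [← hS, sub_self, mul_zero, add_zero] at h3
    exact ge_of_tendsto' h3 h1
  refine ⟨q, hqf, hqfin, hlim, fun p' hp' hfin' => ⟨?_, fun hle => ?_⟩⟩
  · exact hub.trans (hs.tsum_le_of_sum_range_le (hp'.sum_stepEntropy_le h hfin'))
  -- If the entropy of `p'` is at most `S`, the Pythagorean bound is a tail of the series, so the
  -- iterates converge to `p'` as well as to `q`.
  · have h1 : Tendsto (fun n => ∫ x, (√(p' x) - √(iterDensity w n x)) ^ 2 ∂μ) atTop (𝓝 0) := by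
      refine squeeze_zero (fun n => integral_nonneg fun _ => sq_nonneg _)
        (fun n => (hp'.hellinger_le h hfin' n).trans
          (sub_le_sub_right (hle.trans hub) _)) ?_
      simpa [hS] using hs.hasSum.tendsto_sum_nat.const_sub S
    have h2 : Tendsto h.root atTop (𝓝 (sqrtLp hp'.density.integrable hp'.density.nonneg)) := by
      rw [tendsto_iff_norm_sub_tendsto_zero]
      have := h1.sqrt
      rw [Real.sqrt_zero] at this
      refine this.congr fun n => ?_
      rw [← norm_sqrtLp_sub_sq hp'.density.integrable (h.density n).integrable
        hp'.density.nonneg (h.density n).nonneg, Real.sqrt_sq (norm_nonneg _), norm_sub_rev]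
      rfl
    have h3 : Tendsto h.root atTop (𝓝 (sqrtLp hq.integrable hq.nonneg)) := by
      rw [tendsto_iff_norm_sub_tendsto_zero]
      have := hlim.sqrt
      rw [Real.sqrt_zero] at this
      refine this.congr fun n => ?_
      rw [← norm_sqrtLp_sub_sq (h.density n).integrable hq.integrable
        (h.density n).nonneg hq.nonneg, Real.sqrt_sq (norm_nonneg _)]
      rfl
    have h4 := tendsto_nhds_unique h2 h3
    have h5 := coeFn_sqrtLp hp'.density.integrable hp'.density.nonneg
    rw [h4] at h5
    filter_upwards [h5, coeFn_sqrtLp hq.integrable hq.nonneg] with x e1 e2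
    rw [e1] at e2
    exact (Real.sqrt_inj (hp'.density.nonneg x) (hq.nonneg x)).1 e2

end Limit

/-! ### The disintegration update as multiplication by a density ratio. -/

section Update

variable {X : Type*} [MeasurableSpace X]

theorem isDensity_of_eq_withDensity {P Q : ProbabilityMeasure X} {a : X → ℝ} (ha : Measurable a)
    (ha0 : ∀ x, 0 ≤ a x)
    (h : (Q : Measure X) = (P : Measure X).withDensity fun x => ENNReal.ofReal (a x)) :
    IsDensity (P : Measure X) a := by
  have h1 : ∫⁻ x, ENNReal.ofReal (a x) ∂(P : Measure X) = 1 := by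
    have := congrArg (fun m : Measure X => m Set.univ) h
    simpa using this.symm
  have hi : Integrable a (P : Measure X) :=
    (lintegral_ofReal_ne_top_iff_integrable ha.aestronglyMeasurable (ae_of_all _ ha0)).1
      (by rw [h1]; exact ENNReal.one_ne_top)
  refine ⟨ha, ha0, hi, ?_⟩
  rw [integral_eq_lintegral_of_nonneg_ae (ae_of_all _ ha0) ha.aestronglyMeasurable, h1]
  rfl

/-- The update has the observed push-forward. -/
theorem map_withDensity_rnDeriv_comp {Y : Type*} [MeasurableSpace Y] {φ : X → Y}
    (hφ : Measurable φ) (Pobs : ProbabilityMeasure Y) (P : ProbabilityMeasure X)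
    (hac : (Pobs : Measure Y) ≪ (P : Measure X).map φ) :
    ((P : Measure X).withDensity fun x =>
      (Pobs : Measure Y).rnDeriv ((P : Measure X).map φ) (φ x)).map φ = Pobs := by
  have : IsProbabilityMeasure ((P : Measure X).map φ) :=
    Measure.isProbabilityMeasure_map hφ.aemeasurable
  refine Measure.ext fun B hB => ?_
  rw [Measure.map_apply hφ hB, withDensity_apply _ (hφ hB)]
  conv_rhs => rw [← Measure.withDensity_rnDeriv_eq _ _ hac]
  rw [withDensity_apply _ hB, setLIntegral_map hB (Measure.measurable_rnDeriv _ _) hφ]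

/-- A probability measure dominated by `P` and satisfying the constraint is dominated by the
update of `P`. -/
theorem absolutelyContinuous_withDensity_rnDeriv_comp {Y : Type*} [MeasurableSpace Y] {φ : X → Y}
    (hφ : Measurable φ) {Pobs : ProbabilityMeasure Y} {P R : ProbabilityMeasure X}
    (hRP : (R : Measure X) ≪ (P : Measure X)) (hR : (R : Measure X).map φ = Pobs) :
    (R : Measure X) ≪ (P : Measure X).withDensity fun x =>
      (Pobs : Measure Y).rnDeriv ((P : Measure X).map φ) (φ x) := by
  have hac : (Pobs : Measure Y) ≪ (P : Measure X).map φ := hR ▸ hRP.map hφ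
  have : IsProbabilityMeasure ((P : Measure X).map φ) :=
    Measure.isProbabilityMeasure_map hφ.aemeasurable
  have hpos : ∀ᵐ x ∂(R : Measure X),
      (Pobs : Measure Y).rnDeriv ((P : Measure X).map φ) (φ x) ≠ 0 := by
    have h0 : ∀ᵐ y ∂(R : Measure X).map φ,
        0 < (Pobs : Measure Y).rnDeriv ((P : Measure X).map φ) y := by
      rw [hR]
      exact Measure.rnDeriv_pos hac
    filter_upwards [ae_of_ae_map hφ.aemeasurable h0] with x hx using hx.ne'
  intro A hA
  have hm : Measurable fun x => (Pobs : Measure Y).rnDeriv ((P : Measure X).map φ) (φ x) :=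
    (Measure.measurable_rnDeriv _ _).comp hφ
  rw [withDensity_apply_eq_zero hm] at hA
  have h1 := hRP hA
  refine measure_mono_null (fun x hx => ?_) (measure_union_null h1 (ae_iff.1 hpos))
  by_cases h0 : (Pobs : Measure Y).rnDeriv ((P : Measure X).map φ) (φ x) = 0
  · exact Or.inr (not_not.2 h0)
  · exact Or.inl ⟨h0, hx⟩

variable [StandardBorelSpace X] [Nonempty X]

/-- The data-consistent update multiplies the density by the quotient of the observed and the
predicted density of the data. -/
theorem dciUpdate_eq_withDensity {Y : Type*} [MeasurableSpace Y] {φ : X → Y} (hφ : Measurable φ)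
    (Pobs : ProbabilityMeasure Y) (P : ProbabilityMeasure X)
    (hac : (Pobs : Measure Y) ≪ (P : Measure X).map φ) :
    (dciUpdate φ Pobs P : Measure X) = (P : Measure X).withDensity fun x =>
      (Pobs : Measure Y).rnDeriv ((P : Measure X).map φ) (φ x) := by
  have : IsProbabilityMeasure ((P : Measure X).map φ) :=
    Measure.isProbabilityMeasure_map hφ.aemeasurable
  set r := (Pobs : Measure Y).rnDeriv ((P : Measure X).map φ) with hr
  have hrm : Measurable r := Measure.measurable_rnDeriv _ _
  set κ := ProbabilityTheory.condDistrib (id : X → X) φ (P : Measure X) with hκ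
  change (Pobs : Measure Y).bind κ = _
  refine Measure.ext fun A hA => ?_
  rw [Measure.bind_apply hA κ.measurable.aemeasurable, withDensity_apply _ hA,
    ← Measure.withDensity_rnDeriv_eq _ _ hac,
    lintegral_withDensity_eq_lintegral_mul _ hrm (κ.measurable_coe hA)]
  -- Integrating `r(y) 1_A(x)` against the joint law of `(φ, id)` under `P`, once through the kernel
  -- and once directly, gives the two sides.
  have hf : Measurable fun z : Y × X => r z.1 * A.indicator (fun _ => (1 : ℝ≥0∞)) z.2 :=
    (hrm.comp measurable_fst).mul ((measurable_const.indicator hA).comp measurable_snd)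
  have h1 := Measure.lintegral_compProd (μ := (P : Measure X).map φ) (κ := κ) hf
  rw [hκ, ProbabilityTheory.compProd_map_condDistrib measurable_id.aemeasurable,
    lintegral_map hf (hφ.prodMk measurable_id)] at h1
  rw [← lintegral_indicator hA]
  refine Eq.trans ?_ (Eq.trans h1.symm ?_)
  · refine lintegral_congr fun y => ?_
    simp only
    rw [lintegral_const_mul _ (measurable_const.indicator hA), lintegral_indicator_const hA,
      one_mul]
    rfl
  · refine lintegral_congr fun x => ?_
    by_cases hx : x ∈ A <;> simp [hx, hr]

variable {k : ℕ} [NeZero k] {Y : Fin k → Type*} [∀ i, MeasurableSpace (Y i)]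
  {φ : ∀ i, X → Y i} {Pobs : ∀ i, ProbabilityMeasure (Y i)} {P0 R : ProbabilityMeasure X}

/-- The update factors of the scheme, as real-valued functions. -/
noncomputable def dciFactor (P0 : ProbabilityMeasure X) (φ : ∀ i, X → Y i)
    (Pobs : ∀ i, ProbabilityMeasure (Y i)) (n : ℕ) (x : X) : ℝ :=
  ((Pobs (Fin.ofNat k n) : Measure (Y (Fin.ofNat k n))).rnDeriv
    ((iterate P0 φ Pobs n : Measure X).map (φ (Fin.ofNat k n))) (φ (Fin.ofNat k n) x)).toReal

/-- A disintegration is determined only up to null sets of the predicted law, so every step needs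
the observed law to be dominated by it. Pushing this domination of `R` forward provides that. -/
theorem absolutelyContinuous_iterate (hφ : ∀ i, Measurable (φ i)) (hR : R ∈ gsipSet P0 φ Pobs)
    (n : ℕ) : (R : Measure X) ≪ (iterate P0 φ Pobs n : Measure X) := by
  have hR' := fun i => Set.mem_iInter.1 hR i
  induction n with
  | zero => exact (hR' 0).1
  | succ n ih =>
    have hac : (Pobs (Fin.ofNat k n) : Measure (Y (Fin.ofNat k n))) ≪
        (iterate P0 φ Pobs n : Measure X).map (φ (Fin.ofNat k n)) :=
      (hR' (Fin.ofNat k n)).2 ▸ ih.map (hφ _)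
    rw [iterate, dciUpdate_eq_withDensity (hφ _) _ _ hac]
    exact absolutelyContinuous_withDensity_rnDeriv_comp (hφ _) ih (hR' _).2

theorem observed_absolutelyContinuous (hφ : ∀ i, Measurable (φ i)) (hR : R ∈ gsipSet P0 φ Pobs)
    (n : ℕ) : (Pobs (Fin.ofNat k n) : Measure (Y (Fin.ofNat k n))) ≪
      (iterate P0 φ Pobs n : Measure X).map (φ (Fin.ofNat k n)) :=
  (Set.mem_iInter.1 hR (Fin.ofNat k n)).2 ▸ (absolutelyContinuous_iterate hφ hR n).map (hφ _)

theorem measurable_dciFactor (n : ℕ) :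
    Measurable[MeasurableSpace.comap (φ (Fin.ofNat k n)) inferInstance]
      (dciFactor P0 φ Pobs n) :=
  (Measure.measurable_rnDeriv _ _).ennreal_toReal.comp (comap_measurable _)

theorem measurable_dciFactor' (hφ : ∀ i, Measurable (φ i)) (n : ℕ) :
    Measurable (dciFactor P0 φ Pobs n) :=
  (measurable_dciFactor n).mono (hφ _).comap_le le_rfl

theorem measurable_iterDensity_dciFactor (hφ : ∀ i, Measurable (φ i)) (n : ℕ) :
    Measurable (iterDensity (dciFactor P0 φ Pobs) n) :=
  Finset.measurable_fun_prod _ fun m _ => measurable_dciFactor' hφ m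

theorem iterDensity_dciFactor_nonneg (n : ℕ) (x : X) :
    0 ≤ iterDensity (dciFactor P0 φ Pobs) n x :=
  Finset.prod_nonneg fun _ _ => ENNReal.toReal_nonneg

theorem iterate_eq_withDensity (hφ : ∀ i, Measurable (φ i)) (hR : R ∈ gsipSet P0 φ Pobs)
    (n : ℕ) : (iterate P0 φ Pobs n : Measure X) = (P0 : Measure X).withDensity fun x =>
      ENNReal.ofReal (iterDensity (dciFactor P0 φ Pobs) n x) := by
  induction n with
  | zero => simp [iterate, iterDensity]
  | succ n ih =>
    have hac := observed_absolutelyContinuous hφ hR n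
    have hlt := ae_of_ae_map (hφ _).aemeasurable (Measure.rnDeriv_lt_top
      (Pobs (Fin.ofNat k n) : Measure (Y (Fin.ofNat k n)))
      ((iterate P0 φ Pobs n : Measure X).map (φ (Fin.ofNat k n))))
    have e : (fun x => (Pobs (Fin.ofNat k n) : Measure (Y (Fin.ofNat k n))).rnDeriv
        ((iterate P0 φ Pobs n : Measure X).map (φ (Fin.ofNat k n))) (φ (Fin.ofNat k n) x))
        =ᵐ[(iterate P0 φ Pobs n : Measure X)]
        fun x => ENNReal.ofReal (dciFactor P0 φ Pobs n x) := by
      filter_upwards [hlt] with x hx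
      exact (ENNReal.ofReal_toReal hx.ne).symm
    rw [iterate, dciUpdate_eq_withDensity (hφ _) _ _ hac, withDensity_congr_ae e, ih,
      ← withDensity_mul _ (measurable_iterDensity_dciFactor hφ n).ennreal_ofReal
        (measurable_dciFactor' hφ n).ennreal_ofReal]
    congr 1
    funext x
    rw [iterDensity_succ, ENNReal.ofReal_mul (iterDensity_dciFactor_nonneg n x)]
    rfl

theorem map_iterate_succ (hφ : ∀ i, Measurable (φ i)) (hR : R ∈ gsipSet P0 φ Pobs) (n : ℕ) :
    (iterate P0 φ Pobs (n + 1) : Measure X).map (φ (Fin.ofNat k n)) = Pobs (Fin.ofNat k n) := by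
  have hac := observed_absolutelyContinuous hφ hR n
  rw [iterate, dciUpdate_eq_withDensity (hφ _) _ _ hac, map_withDensity_rnDeriv_comp (hφ _) _ _ hac]

theorem isScaling_dciFactor (hφ : ∀ i, Measurable (φ i)) (hR : R ∈ gsipSet P0 φ Pobs) :
    IsScaling (P0 : Measure X) (fun i => MeasurableSpace.comap (φ i) inferInstance)
      (Fin.ofNat k) (dciFactor P0 φ Pobs) where
  le i := (hφ i).comap_le
  measurable n := measurable_dciFactor n
  nonneg _ _ := ENNReal.toReal_nonneg
  density n := isDensity_of_eq_withDensity (measurable_iterDensity_dciFactor hφ n)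
    (iterDensity_dciFactor_nonneg n) (iterate_eq_withDensity hφ hR n)

/-- Feasible densities are the densities of the measures in the solution set. -/
theorem isFeasible_iff_mem_gsipSet (hφ : ∀ i, Measurable (φ i)) (hR : R ∈ gsipSet P0 φ Pobs)
    {P : ProbabilityMeasure X} {a : X → ℝ} (ha : Measurable a) (ha0 : ∀ x, 0 ≤ a x)
    (h : (P : Measure X) = (P0 : Measure X).withDensity fun x => ENNReal.ofReal (a x)) :
    IsFeasible (P0 : Measure X) (fun i => MeasurableSpace.comap (φ i) inferInstance)
      (Fin.ofNat k) (dciFactor P0 φ Pobs) a ↔ P ∈ gsipSet P0 φ Pobs := by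
  have key : ∀ n (B : Set (Y (Fin.ofNat k n))), MeasurableSet B →
      ∫⁻ x in φ (Fin.ofNat k n) ⁻¹' B,
        ENNReal.ofReal (iterDensity (dciFactor P0 φ Pobs) (n + 1) x) ∂(P0 : Measure X) =
      (Pobs (Fin.ofNat k n) : Measure (Y (Fin.ofNat k n))) B := fun n B hB => by
    rw [← withDensity_apply _ (hφ _ hB), ← iterate_eq_withDensity hφ hR,
      ← Measure.map_apply (hφ _) hB, map_iterate_succ hφ hR]
  have key' : ∀ i (B : Set (Y i)), MeasurableSet B →
      ∫⁻ x in φ i ⁻¹' B, ENNReal.ofReal (a x) ∂(P0 : Measure X) =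
      (P : Measure X).map (φ i) B := fun i B hB => by
    rw [← withDensity_apply _ (hφ _ hB), ← h, ← Measure.map_apply (hφ _) hB]
  constructor
  · refine fun hf => Set.mem_iInter.2 fun i => ⟨h ▸ withDensity_absolutelyContinuous _ _, ?_⟩
    -- Constraint `i` is read off at step `n = i` of the first cycle.
    have hi : Fin.ofNat k i = i := Fin.ofNat_val_eq_self i
    refine Measure.ext fun B hB => ?_
    have := fun B hB => hf.marginal i (φ (Fin.ofNat k i) ⁻¹' B) ⟨B, hB, rfl⟩
    rw [hi] at this
    have key2 := key i
    rw [hi] at key2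
    rw [← key' i B hB, this B hB, key2 B hB]
  · refine fun hP => ⟨isDensity_of_eq_withDensity ha ha0 h, fun n A hA => ?_⟩
    obtain ⟨B, hB, rfl⟩ := hA
    rw [key n B hB, key' _ B hB, (Set.mem_iInter.1 hP (Fin.ofNat k n)).2]

end Update

/-! ### Relative entropy, differential entropy and total variation. -/

section Entropy

variable {X : Type*} [MeasurableSpace X]

/-- The real density of `P` with respect to `P0`. -/
noncomputable def realDensity (P0 P : ProbabilityMeasure X) (x : X) : ℝ :=
  ((P : Measure X).rnDeriv (P0 : Measure X) x).toReal

theorem measurable_realDensity (P0 P : ProbabilityMeasure X) : Measurable (realDensity P0 P) :=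
  (Measure.measurable_rnDeriv _ _).ennreal_toReal

theorem eq_withDensity_realDensity {P0 P : ProbabilityMeasure X}
    (h : (P : Measure X) ≪ (P0 : Measure X)) :
    (P : Measure X) = (P0 : Measure X).withDensity fun x =>
      ENNReal.ofReal (realDensity P0 P x) := by
  conv_lhs => rw [← Measure.withDensity_rnDeriv_eq _ _ h]
  refine withDensity_congr_ae ?_
  filter_upwards [Measure.rnDeriv_lt_top (P : Measure X) (P0 : Measure X)] with x hx
  exact (ENNReal.ofReal_toReal hx.ne).symm

theorem klDiv_ne_top_iff_integrable {P0 P : ProbabilityMeasure X}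
    (h : (P : Measure X) ≪ (P0 : Measure X)) :
    InformationTheory.klDiv (P : Measure X) (P0 : Measure X) ≠ ∞ ↔
      Integrable (fun x => realDensity P0 P x * Real.log (realDensity P0 P x))
        (P0 : Measure X) := by
  rw [InformationTheory.klDiv_ne_top_iff, and_iff_right h]
  exact (integrable_rnDeriv_mul_log_iff h).symm

theorem klDiv_eq_ofReal_integral {P0 P : ProbabilityMeasure X}
    (h : (P : Measure X) ≪ (P0 : Measure X))
    (hi : Integrable (fun x => realDensity P0 P x * Real.log (realDensity P0 P x))
      (P0 : Measure X)) :
    InformationTheory.klDiv (P : Measure X) (P0 : Measure X) =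
      ENNReal.ofReal
        (∫ x, realDensity P0 P x * Real.log (realDensity P0 P x) ∂(P0 : Measure X)) := by
  rw [InformationTheory.klDiv_of_ac_of_integrable h ((integrable_rnDeriv_mul_log_iff h).1 hi),
    ← integral_rnDeriv_mul_log h]
  simp [realDensity]

theorem negMulLog_le_one {x : ℝ} (hx : 0 ≤ x) : Real.negMulLog x ≤ 1 := by
  rcases hx.eq_or_lt with rfl | h
  · simp
  · have h1 := mul_le_mul_of_nonneg_left (Real.one_sub_inv_le_log_of_pos h) hx
    rw [mul_sub, mul_inv_cancel₀ h.ne'] at h1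
    rw [Real.negMulLog]
    linarith

variable {ν : Measure X} {P0 P : ProbabilityMeasure X}

theorem IsUniform.univ_ne_zero (h : IsUniform ν P0) : ν Set.univ ≠ 0 := fun h0 => by
  have := congrArg (fun m : Measure X => m Set.univ) h
  simp [h0] at this

theorem IsUniform.univ_ne_top (h : IsUniform ν P0) : ν Set.univ ≠ ∞ := fun h0 => by
  have := congrArg (fun m : Measure X => m Set.univ) h
  simp [h0] at this

theorem IsUniform.eq_smul (h : IsUniform ν P0) : ν = ν Set.univ • (P0 : Measure X) := by
  have h' : (P0 : Measure X) = (ν Set.univ)⁻¹ • ν := h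
  conv_rhs => rw [h']
  rw [smul_smul, ENNReal.mul_inv_cancel h.univ_ne_zero h.univ_ne_top, one_smul]

/-- The integrand of the differential entropy in terms of the density with respect to the uniform
distribution. -/
theorem IsUniform.negMulLog_rnDeriv (h : IsUniform ν P0) :
    ∀ᵐ x ∂ν, Real.negMulLog ((P : Measure X).rnDeriv ν x).toReal =
      (ν Set.univ).toReal⁻¹ * (Real.log (ν Set.univ).toReal * realDensity P0 P x -
        realDensity P0 P x * Real.log (realDensity P0 P x)) := by
  have : IsFiniteMeasure ν := ⟨lt_top_iff_ne_top.2 h.univ_ne_top⟩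
  have hV : 0 < (ν Set.univ).toReal := ENNReal.toReal_pos h.univ_ne_zero h.univ_ne_top
  have h1 := Measure.rnDeriv_smul_right_of_ne_top' (P : Measure X) ν
    (ENNReal.inv_ne_zero.2 h.univ_ne_top) (ENNReal.inv_ne_top.2 h.univ_ne_zero)
  have h' : (P0 : Measure X) = (ν Set.univ)⁻¹ • ν := h
  rw [← h'] at h1
  filter_upwards [h1] with x hx
  have e : realDensity P0 P x = (ν Set.univ).toReal * ((P : Measure X).rnDeriv ν x).toReal := by
    rw [realDensity, hx]
    simp
  rw [e]
  generalize ((P : Measure X).rnDeriv ν x).toReal = t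
  by_cases ht : t = 0
  · simp [ht]
  · rw [Real.log_mul hV.ne' ht, Real.negMulLog]
    field_simp
    ring

/-- The differential entropy is the log-volume minus the relative entropy with respect to the
uniform distribution. -/
theorem IsUniform.differentialEntropy_eq (h : IsUniform ν P0)
    (hac : (P : Measure X) ≪ (P0 : Measure X))
    (hi : Integrable (fun x => realDensity P0 P x * Real.log (realDensity P0 P x))
      (P0 : Measure X)) :
    differentialEntropy ν P = ((Real.log (ν Set.univ).toReal -
      ∫ x, realDensity P0 P x * Real.log (realDensity P0 P x) ∂(P0 : Measure X) : ℝ) : EReal) := by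
  have hV : 0 < (ν Set.univ).toReal := ENNReal.toReal_pos h.univ_ne_zero h.univ_ne_top
  have h' : (P0 : Measure X) = (ν Set.univ)⁻¹ • ν := h
  have hacν : (P : Measure X) ≪ ν :=
    hac.trans (by rw [h']; exact Measure.smul_absolutelyContinuous)
  have hd := isDensity_of_eq_withDensity (measurable_realDensity P0 P)
    (fun _ => ENNReal.toReal_nonneg) (eq_withDensity_realDensity hac)
  have hi' : Integrable (fun x => (ν Set.univ).toReal⁻¹ *
      (Real.log (ν Set.univ).toReal * realDensity P0 P x -
        realDensity P0 P x * Real.log (realDensity P0 P x))) (P0 : Measure X) :=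
    ((hd.integrable.const_mul _).sub hi).const_mul _
  have hiν : Integrable (fun x => Real.negMulLog ((P : Measure X).rnDeriv ν x).toReal) ν := by
    refine Integrable.congr ?_ (h.negMulLog_rnDeriv.mono fun _ => Eq.symm)
    rw [h.eq_smul]
    simpa using hi'.smul_measure h.univ_ne_top
  have hval : ∫ x, Real.negMulLog ((P : Measure X).rnDeriv ν x).toReal ∂ν =
      Real.log (ν Set.univ).toReal -
        ∫ x, realDensity P0 P x * Real.log (realDensity P0 P x) ∂(P0 : Measure X) := by
    rw [integral_congr_ae h.negMulLog_rnDeriv]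
    have e : ∀ g : X → ℝ, ∫ x, g x ∂ν = (ν Set.univ).toReal * ∫ x, g x ∂(P0 : Measure X) :=
      fun g => by
        conv_lhs => rw [h.eq_smul]
        rw [integral_smul_measure, smul_eq_mul]
    rw [e, integral_const_mul, integral_sub (hd.integrable.const_mul _) hi, integral_const_mul,
      hd.integral_eq_one]
    field_simp
  rw [differentialEntropy, if_pos hacν, ← hval,
    integral_eq_lintegral_pos_part_sub_lintegral_neg_part hiν, EReal.coe_sub,
    EReal.coe_ennreal_toReal, EReal.coe_ennreal_toReal]
  · exact (lintegral_ofReal_le_lintegral_enorm _).trans_lt hiν.neg.2 |>.ne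
  · exact (lintegral_ofReal_le_lintegral_enorm _).trans_lt hiν.2 |>.ne

/-- The differential entropy of a measure of infinite relative entropy is `-∞`. -/
theorem IsUniform.differentialEntropy_eq_bot (h : IsUniform ν P0)
    (hac : (P : Measure X) ≪ (P0 : Measure X))
    (hi : ¬ Integrable (fun x => realDensity P0 P x * Real.log (realDensity P0 P x))
      (P0 : Measure X)) :
    differentialEntropy ν P = ⊥ := by
  have : IsFiniteMeasure ν := ⟨lt_top_iff_ne_top.2 h.univ_ne_top⟩
  have hV : 0 < (ν Set.univ).toReal := ENNReal.toReal_pos h.univ_ne_zero h.univ_ne_top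
  have h' : (P0 : Measure X) = (ν Set.univ)⁻¹ • ν := h
  have hacν : (P : Measure X) ≪ ν :=
    hac.trans (by rw [h']; exact Measure.smul_absolutelyContinuous)
  have hd := isDensity_of_eq_withDensity (measurable_realDensity P0 P)
    (fun _ => ENNReal.toReal_nonneg) (eq_withDensity_realDensity hac)
  set g : X → ℝ := fun x => Real.negMulLog ((P : Measure X).rnDeriv ν x).toReal with hg
  have hgm : Measurable g :=
    Real.continuous_negMulLog.measurable.comp (Measure.measurable_rnDeriv _ _).ennreal_toReal
  have htop : ∫⁻ x, ENNReal.ofReal (-g x) ∂ν = ∞ := by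
    by_contra hne
    refine hi ?_
    have hneg : Integrable (fun x => max (-g x) 0) ν := by
      refine (lintegral_ofReal_ne_top_iff_integrable (f := fun x => max (-g x) 0)
        (hgm.neg.max measurable_const).aestronglyMeasurable
        (ae_of_all _ fun x => le_max_right _ _)).1 ?_
      have e : ∀ x, ENNReal.ofReal (max (-g x) 0) = ENNReal.ofReal (-g x) := fun x => by
        rcases le_total (-g x) 0 with h0 | h0
        · rw [max_eq_right h0, ENNReal.ofReal_zero, ENNReal.ofReal_of_nonpos h0]
        · rw [max_eq_left h0]
      simpa only [e] using hne
    -- The integrand is at most 1 and `ν` is finite, so a finite negative part makes `g` integrable.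
    have hgi : Integrable g ν := by
      refine integrable_of_le_of_le_ae hgm.aestronglyMeasurable hneg.neg (integrable_const (1 : ℝ))
        (ae_of_all _ fun x => ?_) (ae_of_all _ fun x => negMulLog_le_one ENNReal.toReal_nonneg)
      have := le_max_left (-g x) 0
      simp only [Pi.neg_apply]
      linarith
    have hgi0 : Integrable (fun x => (ν Set.univ).toReal⁻¹ *
      (Real.log (ν Set.univ).toReal * realDensity P0 P x -
        realDensity P0 P x * Real.log (realDensity P0 P x))) (P0 : Measure X) := by
      rw [h']
      exact (hgi.congr h.negMulLog_rnDeriv).smul_measure (ENNReal.inv_ne_top.2 h.univ_ne_zero)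
    refine ((hd.integrable.const_mul (Real.log (ν Set.univ).toReal)).sub
      (hgi0.const_mul (ν Set.univ).toReal)).congr (ae_of_all _ fun x => ?_)
    simp only [Pi.sub_apply]
    field_simp
    ring
  rw [differentialEntropy, if_pos hacν, htop, EReal.coe_ennreal_top, EReal.sub_top]

/-- Smaller relative entropy with respect to the uniform distribution means larger differential
entropy. -/
theorem IsUniform.differentialEntropy_lt {ν : Measure X} {P Q : ProbabilityMeasure X}
    (h : IsUniform ν P0) (hP : (P : Measure X) ≪ (P0 : Measure X))
    (hlt : InformationTheory.klDiv (Q : Measure X) (P0 : Measure X) <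
      InformationTheory.klDiv (P : Measure X) (P0 : Measure X)) :
    differentialEntropy ν P < differentialEntropy ν Q := by
  have hQ := (InformationTheory.klDiv_ne_top_iff.1 hlt.ne_top).1
  have hQi := (klDiv_ne_top_iff_integrable hQ).1 hlt.ne_top
  rw [h.differentialEntropy_eq hQ hQi]
  by_cases hPi : Integrable (fun x => realDensity P0 P x * Real.log (realDensity P0 P x))
      (P0 : Measure X)
  · rw [h.differentialEntropy_eq hP hPi, EReal.coe_lt_coe_iff]
    rw [klDiv_eq_ofReal_integral hP hPi, klDiv_eq_ofReal_integral hQ hQi] at hlt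
    have := (ENNReal.ofReal_lt_ofReal_iff'.1 hlt).1
    linarith
  · rw [h.differentialEntropy_eq_bot hP hPi]
    exact EReal.bot_lt_coe _

/-- The total variation distance is controlled by the Hellinger distance of the densities. -/
theorem tvDist_le {P Q : ProbabilityMeasure X} {a b : X → ℝ} (ha : IsDensity (P0 : Measure X) a)
    (hb : IsDensity (P0 : Measure X) b)
    (hP : (P : Measure X) = (P0 : Measure X).withDensity fun x => ENNReal.ofReal (a x))
    (hQ : (Q : Measure X) = (P0 : Measure X).withDensity fun x => ENNReal.ofReal (b x)) :
    tvDist P Q ≤ 2 * √(∫ x, (√(a x) - √(b x)) ^ 2 ∂(P0 : Measure X)) := by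
  have : Nonempty {A : Set X // MeasurableSet A} := ⟨⟨∅, MeasurableSet.empty⟩⟩
  refine ciSup_le fun A => ?_
  have e : ∀ {c : X → ℝ}, IsDensity (P0 : Measure X) c →
      ((P0 : Measure X).withDensity fun x => ENNReal.ofReal (c x)).real A =
        ∫ x in A, c x ∂(P0 : Measure X) := fun {c} hc => by
    rw [measureReal_def, withDensity_apply _ A.2, hc.setLIntegral,
      ENNReal.toReal_ofReal (integral_nonneg hc.nonneg)]
  rw [hP, hQ, e ha, e hb]
  exact abs_setIntegral_sub_le ha hb A

theorem tvDist_nonneg (P Q : ProbabilityMeasure X) : 0 ≤ tvDist P Q :=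
  Real.iSup_nonneg fun _ => abs_nonneg _

end Entropy

/-! ### Transfer from densities to measures. -/

section Convergence

variable {X : Type*} [MeasurableSpace X] [StandardBorelSpace X] [Nonempty X]
  {k : ℕ} [NeZero k] {Y : Fin k → Type*} [∀ i, MeasurableSpace (Y i)]
  {φ : ∀ i, X → Y i} {Pobs : ∀ i, ProbabilityMeasure (Y i)} {P0 : ProbabilityMeasure X}

/-- The witness is `n + ((i - n) mod k)`, with `k - n % k` standing for `-n`. -/
theorem exists_ofNat_eq (i : Fin k) (n : ℕ) : ∃ m, n ≤ m ∧ m < n + k ∧ Fin.ofNat k m = i := by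
  have hk : 0 < k := NeZero.pos k
  have hn := Nat.mod_lt n hk
  refine ⟨n + (i + (k - n % k)) % k, Nat.le_add_right _ _,
    Nat.add_lt_add_left (Nat.mod_lt _ hk) _, Fin.ext ?_⟩
  have e : n + (i + (k - n % k)) = i + k * (n / k + 1) := by
    have := Nat.div_add_mod n k
    rw [Nat.mul_add]
    omega
  change (n + (i + (k - n % k)) % k) % k = i
  rw [Nat.add_mod_mod, e, Nat.add_mul_mod_self_left, Nat.mod_eq_of_lt i.2]

/-- The iterative scheme converges in total variation to the unique minimizer of the relative
entropy in the solution set. -/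
theorem exists_tendsto_tvDist_iterate (hφ : ∀ i, Measurable (φ i))
    (hfin : (⨅ P ∈ gsipSet P0 φ Pobs,
      InformationTheory.klDiv (P : Measure X) (P0 : Measure X)) < ∞) :
    ∃ Q : ProbabilityMeasure X,
      Tendsto (fun n => tvDist (iterate P0 φ Pobs n) Q) atTop (𝓝 0) ∧
      Q ∈ gsipSet P0 φ Pobs ∧
      ∀ P ∈ gsipSet P0 φ Pobs, P ≠ Q →
        InformationTheory.klDiv (Q : Measure X) (P0 : Measure X) <
          InformationTheory.klDiv (P : Measure X) (P0 : Measure X) := by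
  obtain ⟨R, hR, hRfin⟩ : ∃ R ∈ gsipSet P0 φ Pobs,
      InformationTheory.klDiv (R : Measure X) (P0 : Measure X) < ∞ := by
    simpa only [iInf_lt_iff, exists_prop] using hfin
  have hac : ∀ {P}, P ∈ gsipSet P0 φ Pobs → (P : Measure X) ≪ (P0 : Measure X) := fun hP =>
    (Set.mem_iInter.1 hP (Fin.ofNat k 0)).1
  have hfeas : ∀ {P}, P ∈ gsipSet P0 φ Pobs → IsFeasible (P0 : Measure X)
      (fun i => MeasurableSpace.comap (φ i) inferInstance) (Fin.ofNat k) (dciFactor P0 φ Pobs)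
      (realDensity P0 P) := fun hP =>
    (isFeasible_iff_mem_gsipSet hφ hR (measurable_realDensity P0 _)
      (fun _ => ENNReal.toReal_nonneg) (eq_withDensity_realDensity (hac hP))).2 hP
  have hs := isScaling_dciFactor hφ hR
  obtain ⟨q, hq, hqfin, hlim, hmin⟩ := (hfeas hR).exists_minimizer hs
    ((klDiv_ne_top_iff_integrable (hac hR)).1 hRfin.ne) exists_ofNat_eq
  have hprob : IsProbabilityMeasure
      ((P0 : Measure X).withDensity fun x => ENNReal.ofReal (q x)) := ⟨by
    rw [withDensity_apply _ MeasurableSet.univ, hq.density.setLIntegral, setIntegral_univ,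
      hq.density.integral_eq_one, ENNReal.ofReal_one]⟩
  set Q : ProbabilityMeasure X :=
    ⟨(P0 : Measure X).withDensity fun x => ENNReal.ofReal (q x), hprob⟩ with hQ
  have hQeq : (Q : Measure X) = (P0 : Measure X).withDensity fun x => ENNReal.ofReal (q x) := rfl
  have hQmem : Q ∈ gsipSet P0 φ Pobs :=
    (isFeasible_iff_mem_gsipSet hφ hR hq.density.measurable hq.density.nonneg hQeq).1 hq
  have hQq : realDensity P0 Q =ᵐ[(P0 : Measure X)] q := by
    have := Measure.rnDeriv_withDensity (P0 : Measure X) hq.density.measurable.ennreal_ofReal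
    filter_upwards [this] with x hx
    rw [realDensity, hQeq, hx, ENNReal.toReal_ofReal (hq.density.nonneg x)]
  have hQq' : (fun x => realDensity P0 Q x * Real.log (realDensity P0 Q x))
      =ᵐ[(P0 : Measure X)] fun x => q x * Real.log (q x) := by
    filter_upwards [hQq] with x hx
    rw [hx]
  have hQfin := hqfin.congr hQq'.symm
  refine ⟨Q, ?_, hQmem, fun P hP hne => ?_⟩
  · refine squeeze_zero (fun n => tvDist_nonneg _ _) (fun n => tvDist_le (hs.density n) hq.density
      (iterate_eq_withDensity hφ hR n) hQeq) ?_
    simpa using (hlim.sqrt.const_mul 2)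
  · by_cases hPfin : InformationTheory.klDiv (P : Measure X) (P0 : Measure X) = ∞
    · rw [hPfin]
      exact ((klDiv_ne_top_iff_integrable (hac hQmem)).2 hQfin).lt_top
    · have hPi := (klDiv_ne_top_iff_integrable (hac hP)).1 hPfin
      obtain ⟨h1, h2⟩ := hmin _ (hfeas hP) hPi
      have hlt : ∫ x, q x * Real.log (q x) ∂(P0 : Measure X) <
          ∫ x, realDensity P0 P x * Real.log (realDensity P0 P x) ∂(P0 : Measure X) := by
        refine lt_of_not_ge fun hle => hne (Subtype.ext ?_)
        refine (eq_withDensity_realDensity (hac hP)).trans (withDensity_congr_ae ?_)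
        filter_upwards [h2 hle] with x hx
        rw [hx]
      -- Strict monotonicity of `ENNReal.ofReal` needs the larger value positive. Nonnegativity here
      -- is the entropy bound for the empty partial sum.
      have h0 : 0 ≤ ∫ x, q x * Real.log (q x) ∂(P0 : Measure X) :=
        (Finset.sum_nonneg fun n _ => hq.stepEntropy_nonneg hs hqfin n).trans
          (hq.sum_stepEntropy_le hs hqfin 0)
      rw [klDiv_eq_ofReal_integral (hac hP) hPi, klDiv_eq_ofReal_integral (hac hQmem) hQfin,
        integral_congr_ae hQq', ENNReal.ofReal_lt_ofReal_iff (h0.trans_lt hlt)]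
      exact hlt

end Convergence

end IterativeDCI

theorem mainTheorem3 {p k : ℕ} [NeZero k] {d : Fin k → ℕ}
    (Λ : Set (EuclideanSpace ℝ (Fin p))) [PolishSpace Λ] [Nonempty Λ]
    (D : ∀ i, Set (EuclideanSpace ℝ (Fin (d i)))) [∀ i, PolishSpace (D i)]
    (φ : ∀ i, Λ → D i) (hφ : ∀ i, Measurable (φ i))
    (Pobs : ∀ i, ProbabilityMeasure (D i))
    (P0 : ProbabilityMeasure Λ) (hunif : IterativeDCI.IsUniform (IterativeDCI.lebesgueOn Λ) P0)
    (hfin : (⨅ P ∈ IterativeDCI.gsipSet P0 φ Pobs,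
      InformationTheory.klDiv (P : Measure Λ) (P0 : Measure Λ)) < ∞)
    (hpred : ∃ C : ℝ, 0 < C ∧ ∀ i, ∀ᵐ ω ∂((P0 : Measure Λ).map (φ i)),
      ENNReal.ofReal (1 / C) ≤
        (Pobs i : Measure (D i)).rnDeriv ((P0 : Measure Λ).map (φ i)) ω ∧
      (Pobs i : Measure (D i)).rnDeriv ((P0 : Measure Λ).map (φ i)) ω ≤ ENNReal.ofReal C) :
    ∃ Pinf : ProbabilityMeasure Λ,
      Tendsto (fun n => IterativeDCI.tvDist (IterativeDCI.iterate P0 φ Pobs n) Pinf)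
        atTop (𝓝 0) ∧
      Pinf ∈ IterativeDCI.gsipSet P0 φ Pobs ∧
      IsMinOn (fun P : ProbabilityMeasure Λ =>
          InformationTheory.klDiv (P : Measure Λ) (P0 : Measure Λ))
        (IterativeDCI.gsipSet P0 φ Pobs) Pinf ∧
      ∀ P ∈ IterativeDCI.gsipSet P0 φ Pobs, P ≠ Pinf →
        IterativeDCI.differentialEntropy (IterativeDCI.lebesgueOn Λ) P <
          IterativeDCI.differentialEntropy (IterativeDCI.lebesgueOn Λ) Pinf := by
  obtain ⟨Q, hlim, hQ, hmin⟩ := IterativeDCI.exists_tendsto_tvDist_iterate hφ hfin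
  refine ⟨Q, hlim, hQ, fun P hP => ?_, fun P hP hne => ?_⟩
  · by_cases hPQ : P = Q
    · exact hPQ ▸ le_refl (InformationTheory.klDiv (P : Measure Λ) (P0 : Measure Λ))
    · exact (hmin P hP hPQ).le
  · exact hunif.differentialEntropy_lt (Set.mem_iInter.1 hP (Fin.ofNat k 0)).1 (hmin P hP hne)
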